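/- Let $X$ be an infinite-dimensional complex Banach space and let $A$ be a closed densely defined linear operator in $X$ with domain $\mathcal D(A)$. Write $\sigma(A)=\{\lambda\in\mathbb C:\lambda-A\colon\mathcal D(A)\to X\text{ is not bijective}\}$. Call $A$ Fredholm if its range is closed and of finite codimension and its null space is finite-dimensional; Browder if it is Fredholm and $\mathcal N(A^n)=\mathcal N(A^{n+1})$, $\mathcal R(A^m)=\mathcal R(A^{m+1})$ for some $n,m\ge 0$. Let $\sigma_e(A)$, $\sigma_b(A)$ be the sets of $\lambda\in\mathbb C$ for which $A-\lambda$ is not Fredholm, respectively not Browder; the Riesz points of $A$ are the elements of $p_{00}(A)=\sigma(A)\setminus\sigma_b(A)$. A bounded operator $R$ on $X$ is Riesz if $\sigma_e(R)=\{0\}$. Let $\widehat{\mathcal C}(X)$ be the set of closed densely defined $A$ such that $\sigma_e(A)\ne\mathbb C$ and $\mathcal D(A^{j+1})=\mathcal D(A^j)$ for all sufficiently large $j$. $A$ is generalized Drazin-Riesz invertible if there is a bounded operator $B$ on $X$ with $\mathcal R(B)\subset\mathcal D(A)$, $\mathcal R(I-AB)\subset\mathcal D(A)$, $BAB=B$,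 $ABx=BAx$ for all $x\in\mathcal D(A)$, and $A(I-AB)$ bounded and Riesz. A bounded spectral set of $A$ is a bounded set $\sigma\subset\sigma(A)$ that is open and closed in $\sigma(A)\cup\{\infty\}\subset\mathbb C\cup\{\infty\}$; the spectral projection $P_\sigma$ is the bounded projection with null space $M$ and range $N$, where $X=M\oplus N$ with $M,N$ closed, $N\subset\mathcal D(A)$, $A(N)\subset N$, $A(M\cap\mathcal D(A))\subset M$, $\sigma(A|_M)=\sigma(A)\setminus\sigma$ and $\sigma(A|_N)=\sigma$. If $A$ is not invertible and $0\in\sigma$, the Drazin inverse of $A$ related to $\sigma$ is $A^{D,\sigma}=(A-\xi P_\sigma)^{-1}(I-P_\sigma)$ for some $\xi\in\mathbb C$ with $|\xi|>2\sup_{\lambda\in\sigma}|\lambda|$. **Theorem.** Let $(T(t))_{t\ge0}$ be a bounded $C_0$-semigroup on $X$ whose infinitesimal generator $A$ belongs to $\widehat{\mathcal C}(X)$, and suppose that $0$ is an accumulation point of $\sigma(A)$. Let $P\ne0$ be a bounded projection on $X$ such that (i) $T(t)P=PT(t)$ for all $t\ge0$; (ii) $\mathcal R(P)\subset\mathcal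 D(A)$; (iii) $\|T(t)(I-P)\|\to0$ as $t\to+\infty$; (iv) $\sigma(AP)=\{0,\mu_1,\mu_2,\dots\}$, where $(\mu_i)_{i\ge1}$ is a sequence in $p_{00}(A)\setminus\{0\}$ converging to $0$ such that $(|\mu_i|)_{i\ge1}$ is non-increasing and $|\mu_1|<\tfrac12$. Then $A$ is generalized Drazin-Riesz invertible, $A-P\colon\mathcal D(A)\to X$ has a bounded inverse, and there are a bounded projection $Q$ on $X$ and constants $M,\mu>0$ such that $\sigma(AQ)$ is a bounded spectral set of $A$ containing $0$, $Q$ is the spectral projection of $A$ relative to $\sigma(AQ)$, the Drazin inverse $A^{D,\sigma(AQ)}$ exists, $$\|T(t)(I-P)\|\le Me^{-\mu t}\qquad(t\ge0),$$ and $$A^{D,\sigma(AQ)}(I-P)=(A-P)^{-1}(I-P)=-\int_0^{\infty}T(t)(I-P)\,dt,$$ where the integral converges absolutely in the strong sense, that is, $t\mapsto T(t)(I-P)x$ is Bochner integrable on $(0,\infty)$ for every $x\in X$. -/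

import Mathlib

open Filter Topology MeasureTheory

namespace DrazinRiesz

section Algebraic

variable {E : Type*} [AddCommGroup E] [Module ℂ E]

/-- An everywhere defined linear operator, seen as an operator with domain. -/
def ofMap (B : E →ₗ[ℂ] E) : E →ₗ.[ℂ] E := B.toPMap ⊤

/-- The perturbation `A - B` of `A` by an everywhere defined `B`; its domain is that of `A`. -/
def subMap (A : E →ₗ.[ℂ] E) (B : E →ₗ[ℂ] E) : E →ₗ.[ℂ] E where
  domain := A.domain
  toFun := A.toFun - B ∘ₗ A.domain.subtype

/-- The operator `A - z` with the domain of `A`. -/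
def shift (A : E →ₗ.[ℂ] E) (z : ℂ) : E →ₗ.[ℂ] E := subMap A (z • LinearMap.id)

/-- The composition `x ↦ g (f x)` on its natural domain
`{x ∈ D(f) : f x ∈ D(g)}`. -/
def pcomp (g f : E →ₗ.[ℂ] E) : E →ₗ.[ℂ] E where
  domain :=
    { carrier := {x | ∃ h : x ∈ f.domain, f ⟨x, h⟩ ∈ g.domain}
      zero_mem' := ⟨f.domain.zero_mem, by
        have : f ⟨0, f.domain.zero_mem⟩ = 0 := f.map_zero
        rw [this]; exact g.domain.zero_mem⟩
      add_mem' := by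
        rintro x y ⟨hx, hx'⟩ ⟨hy, hy'⟩
        refine ⟨f.domain.add_mem hx hy, ?_⟩
        have : f ⟨x + y, f.domain.add_mem hx hy⟩ = f ⟨x, hx⟩ + f ⟨y, hy⟩ :=
          f.map_add ⟨x, hx⟩ ⟨y, hy⟩
        rw [this]; exact g.domain.add_mem hx' hy'
      smul_mem' := by
        rintro c x ⟨hx, hx'⟩
        refine ⟨f.domain.smul_mem c hx, ?_⟩
        have : f ⟨c • x, f.domain.smul_mem c hx⟩ = c • f ⟨x, hx⟩ :=
          f.map_smul c ⟨x, hx⟩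
        rw [this]; exact g.domain.smul_mem c hx' }
  toFun :=
    { toFun := fun x => g ⟨f ⟨x.1, x.2.1⟩, x.2.2⟩
      map_add' := by
        intro x y
        rw [← g.map_add]
        congr 1
        exact Subtype.ext (f.map_add ⟨x.1, x.2.1⟩ ⟨y.1, y.2.1⟩)
      map_smul' := by
        intro c x
        rw [RingHom.id_apply, ← g.map_smul]
        congr 1
        exact Subtype.ext (f.map_smul c ⟨x.1, x.2.1⟩) }

/-- The powers `A ^ n`, with domain `{x : x, A x, …, A ^ (n - 1) x ∈ D(A)}`. -/
def pow (A : E →ₗ.[ℂ] E) : ℕ → (E →ₗ.[ℂ] E)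
  | 0 => ofMap LinearMap.id
  | n + 1 => pcomp A (pow A n)

/-- The null space `N(A)`, as a subspace of the whole space. -/
def nullSpace (A : E →ₗ.[ℂ] E) : Submodule ℂ E :=
  (LinearMap.ker A.toFun).map A.domain.subtype

/-- The range `R(A)`. -/
def ran (A : E →ₗ.[ℂ] E) : Submodule ℂ E := LinearMap.range A.toFun

/-- The resolvent set `ρ(A)`. -/
def resolvent (A : E →ₗ.[ℂ] E) : Set ℂ := {z | Function.Bijective (shift A z).toFun}

/-- The spectrum `σ(A)`. -/
def spec (A : E →ₗ.[ℂ] E) : Set ℂ := (resolvent A)ᶜ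

/-- The part of `A` in a subspace `M`, as an operator in `M`, with domain
`{m ∈ M ∩ D(A) : A m ∈ M}`. It is the restriction of `A` to `M ∩ D(A)` as soon as
`A (M ∩ D(A)) ⊆ M`. -/
def part (A : E →ₗ.[ℂ] E) (M : Submodule ℂ E) : M →ₗ.[ℂ] M where
  domain :=
    { carrier := {m | ∃ h : (m : E) ∈ A.domain, A ⟨m, h⟩ ∈ M}
      zero_mem' := ⟨A.domain.zero_mem, by
        have : A ⟨((0 : M) : E), A.domain.zero_mem⟩ = 0 := A.map_zero
        rw [this]; exact M.zero_mem⟩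
      add_mem' := by
        rintro x y ⟨hx, hx'⟩ ⟨hy, hy'⟩
        refine ⟨A.domain.add_mem hx hy, ?_⟩
        have : A ⟨((x + y : M) : E), A.domain.add_mem hx hy⟩ = A ⟨x, hx⟩ + A ⟨y, hy⟩ :=
          A.map_add ⟨x, hx⟩ ⟨y, hy⟩
        rw [this]; exact M.add_mem hx' hy'
      smul_mem' := by
        rintro c x ⟨hx, hx'⟩
        refine ⟨A.domain.smul_mem c hx, ?_⟩
        have : A ⟨((c • x : M) : E), A.domain.smul_mem c hx⟩ = c • A ⟨x, hx⟩ :=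
          A.map_smul c ⟨x, hx⟩
        rw [this]; exact M.smul_mem c hx' }
  toFun :=
    { toFun := fun m => ⟨A ⟨m.1, m.2.1⟩, m.2.2⟩
      map_add' := by
        intro x y
        exact Subtype.ext (A.map_add ⟨x.1, x.2.1⟩ ⟨y.1, y.2.1⟩)
      map_smul' := by
        intro c x
        exact Subtype.ext (A.map_smul c ⟨x.1, x.2.1⟩) }

/-- The compactified spectrum `σ(A) ∪ {∞}` in the Riemann sphere. -/
def extSpec (A : E →ₗ.[ℂ] E) : Set (OnePoint ℂ) :=
  insert OnePoint.infty ((fun z : ℂ => (z : OnePoint ℂ)) '' spec A)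

/-- A subset of the compactified spectrum that is open and closed in its relative topology. -/
def IsSpectralSet (A : E →ₗ.[ℂ] E) (S : Set (OnePoint ℂ)) : Prop :=
  S ⊆ extSpec A ∧ IsClopen {z : extSpec A | (z : OnePoint ℂ) ∈ S}

/-- A bounded spectral set of `A`. -/
def IsBoundedSpectralSet (A : E →ₗ.[ℂ] E) (σ : Set ℂ) : Prop :=
  Bornology.IsBounded σ ∧ IsSpectralSet A ((fun z : ℂ => (z : OnePoint ℂ)) '' σ)

end Algebraic

section Normed

variable {X : Type*} [NormedAddCommGroup X] [NormedSpace ℂ X]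

/-- Fredholm operators: closed range, finite-dimensional null space, range of finite codimension. -/
def IsFredholm (A : X →ₗ.[ℂ] X) : Prop :=
  IsClosed (ran A : Set X) ∧ FiniteDimensional ℂ (nullSpace A) ∧
    FiniteDimensional ℂ (X ⧸ ran A)

def HasFiniteAscent (A : X →ₗ.[ℂ] X) : Prop :=
  ∃ n : ℕ, nullSpace (pow A n) = nullSpace (pow A (n + 1))

def HasFiniteDescent (A : X →ₗ.[ℂ] X) : Prop :=
  ∃ n : ℕ, ran (pow A n) = ran (pow A (n + 1))

def IsBrowder (A : X →ₗ.[ℂ] X) : Prop :=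
  IsFredholm A ∧ HasFiniteAscent A ∧ HasFiniteDescent A

/-- The essential spectrum. -/
def essSpec (A : X →ₗ.[ℂ] X) : Set ℂ := {z | ¬ IsFredholm (shift A z)}

/-- The Browder spectrum. -/
def browderSpec (A : X →ₗ.[ℂ] X) : Set ℂ := {z | ¬ IsBrowder (shift A z)}

/-- The set of Riesz points of `A`. -/
def rieszPoints (A : X →ₗ.[ℂ] X) : Set ℂ := spec A \ browderSpec A

/-- A bounded operator is Riesz if its essential spectrum is `{0}`. -/
def IsRiesz (R : X →L[ℂ] X) : Prop := essSpec (ofMap (R : X →ₗ[ℂ] X)) = {0}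

/-- Closed densely defined operators with nonempty essential resolvent set such that
`D(A ^ (j + 1)) = D(A ^ j)` for all sufficiently large `j`. -/
structure IsHatClosed (A : X →ₗ.[ℂ] X) : Prop where
  closed : A.IsClosed
  dense : Dense (A.domain : Set X)
  essResolvent : (essSpec A)ᶜ.Nonempty
  domains : ∀ᶠ j : ℕ in atTop, (pow A (j + 1)).domain = (pow A j).domain

/-- The product `A B` of `A` with a bounded operator `B`, on its natural domain
`{x : B x ∈ D(A)}`. -/
def mulBdd (A : X →ₗ.[ℂ] X) (B : X →L[ℂ] X) : X →ₗ.[ℂ] X := pcomp A (ofMap (B : X →ₗ[ℂ] X))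

/-- `B` is a generalized Drazin-Riesz inverse of `A`: the ranges of `B` and `I - A B` lie in
`D(A)`, `B A B = B`, `A B = B A` on `D(A)`, and `A (I - A B)` is bounded and Riesz. -/
structure IsGDRInverse (A : X →ₗ.[ℂ] X) (B : X →L[ℂ] X) : Prop where
  range_mem : ∀ x, B x ∈ A.domain
  sub_mem : ∀ x, x - A ⟨B x, range_mem x⟩ ∈ A.domain
  outer : ∀ x, B (A ⟨B x, range_mem x⟩) = B x
  comm : ∀ x : A.domain, B (A x) = A ⟨B x, range_mem x⟩
  riesz : ∃ R : X →L[ℂ] X, IsRiesz R ∧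
    ∀ x, R x = A ⟨x - A ⟨B x, range_mem x⟩, sub_mem x⟩

def IsGDRInvertible (A : X →ₗ.[ℂ] X) : Prop := ∃ B : X →L[ℂ] X, IsGDRInverse A B

/-- `(M, N) ∈ Red(A)`. -/
structure IsReduction (A : X →ₗ.[ℂ] X) (M N : Submodule ℂ X) : Prop where
  closed_left : IsClosed (M : Set X)
  closed_right : IsClosed (N : Set X)
  map_left : ∀ x : A.domain, (x : X) ∈ M → A x ∈ M
  le_domain : N ≤ A.domain
  map_right : ∀ x : A.domain, (x : X) ∈ N → A x ∈ N
  isCompl : IsCompl M N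

/-- `Q` is the spectral projection of `A` relative to the bounded spectral set `σ`: with
`M = N(Q)` and `N = R(Q)`, one has `(M, N) ∈ Red(A)`, `σ(A_M) = σ(A) \ σ` and `σ(A_N) = σ`. -/
structure IsSpectralProjection (A : X →ₗ.[ℂ] X) (σ : Set ℂ) (Q : X →L[ℂ] X) : Prop where
  spectralSet : IsBoundedSpectralSet A σ
  idem : IsIdempotentElem Q
  reduction : IsReduction A (LinearMap.ker (Q : X →ₗ[ℂ] X)) (LinearMap.range (Q : X →ₗ[ℂ] X))
  spec_ker : spec (part A (LinearMap.ker (Q : X →ₗ[ℂ] X))) = spec A \ σ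
  spec_range : spec (part A (LinearMap.range (Q : X →ₗ[ℂ] X))) = σ

/-- The bounded operator `C` is the inverse of `A`. -/
structure IsInverse (A : X →ₗ.[ℂ] X) (C : X →L[ℂ] X) : Prop where
  range_mem : ∀ y, C y ∈ A.domain
  right_inv : ∀ y, A ⟨C y, range_mem y⟩ = y
  left_inv : ∀ x : A.domain, C (A x) = x

/-- `D` is the Drazin inverse `A^{D,σ} = (A - ξ P_σ)⁻¹ (I - P_σ)` of the non-invertible operator
`A` related to the bounded spectral set `σ ∋ 0`, where `|ξ| > 2 sup {|z| : z ∈ σ}`. -/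
def IsDrazinInverse (A : X →ₗ.[ℂ] X) (σ : Set ℂ) (D : X →L[ℂ] X) : Prop :=
  0 ∈ spec A ∧ 0 ∈ σ ∧ ∃ S : X →L[ℂ] X, IsSpectralProjection A σ S ∧
    ∃ ξ : ℂ, 2 * sSup ((fun z : ℂ => ‖z‖) '' σ) < ‖ξ‖ ∧
      ∃ C : X →L[ℂ] X, IsInverse (subMap A ((ξ • S : X →L[ℂ] X) : X →ₗ[ℂ] X)) C ∧
        D = C.comp (ContinuousLinearMap.id ℂ X - S)

/-- `(T t)_{t ≥ 0}` is a `C₀`-semigroup; the values of `T` at negative times play no role. -/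
structure IsC0Semigroup (T : ℝ → X →L[ℂ] X) : Prop where
  zero : T 0 = ContinuousLinearMap.id ℂ X
  add : ∀ s t : ℝ, 0 ≤ s → 0 ≤ t → T (s + t) = (T s).comp (T t)
  strongCont : ∀ x : X, Tendsto (fun t => T t x) (𝓝[>] 0) (𝓝 x)

/-- `A` is the infinitesimal generator of `T`: `x ∈ D(A)` and `A x = y` if and only if
`(T t x - x) / t → y` as `t ↓ 0`. -/
def IsGenerator (T : ℝ → X →L[ℂ] X) (A : X →ₗ.[ℂ] X) : Prop :=
  ∀ x y : X, (x, y) ∈ A.graph ↔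
    Tendsto (fun t : ℝ => (t : ℂ)⁻¹ • (T t x - x)) (𝓝[>] 0) (𝓝 y)

end Normed

end DrazinRiesz

/-!
On the range of the idempotent `1 - P` the semigroup decays in norm, hence exponentially, and
`J x = ∫ T t (x - P x)` is a bounded operator with `(J x, -(x - P x))` in the graph of `A`.
Iterating, `x = Aʲ ((-J)ʲ x)` for every `x` in the kernel of `P`, so the domains of the powers of
`A` can stabilize only if this kernel lies in the domain of `A`. As the range of `P` does too,
`A` is a bounded operator `a`, and `-J` inverts it on the kernel of `P`.

Near `0` the spectrum of `a` is therefore carried by the range of `P`. Its nonzero points are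
Browder points, hence isolated, so that all but finitely many of them lie in a small ball about
`0`; removing the Riesz idempotents of the others from `P` leaves an idempotent `Q` with
`Q P = Q`. Now `a` is invertible on the kernel of `Q`, while `a Q` is Riesz because each of its
nonzero spectral points is a Browder point and `0` is a limit of spectral points. Finally the
Drazin inverse `D` and `C = (a - P)⁻¹` both agree with `-J` on the kernel of `P`, since
`D a = 1 - Q`, `C (a - P) = 1` and `Q J = P J = 0`.
-/

open DrazinRiesz

namespace DrazinRiesz

/-! ### Invertibility and spectrum on the corner of an idempotent -/

section Corner

variable {R : Type*} [Ring R] {c c' e f : R}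

/-- `c` is invertible on the corner of the idempotent `e`. For commuting operators `c` and `e`
this says that `c` restricts to a bijection of the range of `e`, see `isUnitOn_iff_bijOn`. -/
def IsUnitOn (c e : R) : Prop := ∃ d, c * d = e ∧ d * c = e

theorem isUnitOn_one : IsUnitOn c 1 ↔ IsUnit c := isUnit_iff_exists.symm

theorem IsUnitOn.mono (h : IsUnitOn c e) (hfc : Commute f c) (hef : e * f = f) :
    IsUnitOn c f := by
  obtain ⟨d, hcd, hdc⟩ := h
  exact ⟨d * f, by rw [← mul_assoc, hcd, hef], by rw [mul_assoc, hfc.eq, ← mul_assoc, hdc, hef]⟩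

theorem isUnitOn_of_isUnit (h : IsUnit c) (hce : Commute c e) : IsUnitOn c e :=
  (isUnitOn_one.2 h).mono hce.symm (one_mul e)

theorem IsUnitOn.add (he : IsUnitOn c e) (hf : IsUnitOn c f) : IsUnitOn c (e + f) := by
  obtain ⟨d, hcd, hdc⟩ := he
  obtain ⟨d', hcd', hdc'⟩ := hf
  exact ⟨d + d', by rw [mul_add, hcd, hcd'], by rw [add_mul, hdc, hdc']⟩

theorem IsUnitOn.isUnit (he : IsUnitOn c e) (he' : IsUnitOn c (1 - e)) : IsUnit c := by
  rw [← isUnitOn_one, ← add_sub_cancel e 1]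
  exact he.add he'

theorem IsUnitOn.congr (h : IsUnitOn c e) (he : IsIdempotentElem e) (hc'e : Commute c' e)
    (hcc' : c * e = c' * e) : IsUnitOn c' e := by
  obtain ⟨d, hcd, hdc⟩ := h
  have hed : e * d = d * e := by rw [← hdc, mul_assoc, hcd, hdc]
  refine ⟨d * e, ?_, ?_⟩
  · rw [← hed, ← mul_assoc, ← hcc', mul_assoc, hed, ← mul_assoc, hcd, he.eq]
  · rw [mul_assoc, ← hc'e.eq, ← hcc', ← mul_assoc, hdc, he.eq]

theorem isUnitOn_iff_isUnit_add (he : IsIdempotentElem e) (hce : Commute c e) :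
    IsUnitOn c e ↔ IsUnit (c * e + (1 - e)) := by
  have hcomm : Commute (c * e + (1 - e)) e :=
    (hce.mul_left (.refl e)).add_left ((Commute.one_left e).sub_left (.refl e))
  have hcorner : (c * e + (1 - e)) * e = c * e := by
    rw [add_mul, mul_assoc, he.eq, he.one_sub_mul_self, add_zero]
  have hcorner' : (c * e + (1 - e)) * (1 - e) = 1 * (1 - e) := by
    rw [add_mul, mul_assoc, he.mul_one_sub_self, mul_zero, he.one_sub.eq, zero_add, one_mul]
  constructor
  · intro h
    have h' : IsUnitOn (1 : R) (1 - e) := isUnitOn_of_isUnit isUnit_one (.one_left _)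
    exact (h.congr he hcomm hcorner.symm).isUnit
      (h'.congr he.one_sub ((Commute.one_right _).sub_right hcomm) hcorner'.symm)
  · intro h
    exact (isUnitOn_of_isUnit h hcomm).congr he hce hcorner

end Corner

section SpectrumOn

variable {𝕜 R : Type*} [Field 𝕜] [Ring R] [Algebra 𝕜 R] {a e f : R}

theorem isUnitOn_smul_one {z : 𝕜} (hz : z ≠ 0) (e : R) : IsUnitOn (z • (1 : R)) e :=
  ⟨z⁻¹ • e, by simp [hz], by simp [hz]⟩

theorem commute_sub_smul_one (h : Commute a e) (z : 𝕜) : Commute (a - z • 1) e :=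
  h.sub_left ((Commute.one_left e).smul_left z)

theorem isUnit_sub_smul_one_iff {z : 𝕜} : IsUnit (a - z • 1) ↔ z ∉ spectrum 𝕜 a := by
  rw [spectrum.notMem_iff, ← IsUnit.neg_iff, neg_sub, Algebra.algebraMap_eq_smul_one]

variable (𝕜) in
/-- The spectrum of `a` on the corner of the idempotent `e`. For commuting operators this is the
spectrum of the restriction of `a` to the range of `e`, see `spec_part_ofMap`. -/
def spectrumOn (a e : R) : Set 𝕜 := {z | ¬ IsUnitOn (a - z • 1) e}

theorem notMem_spectrumOn {z : 𝕜} : z ∉ spectrumOn 𝕜 a e ↔ IsUnitOn (a - z • 1) e := not_not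

theorem zero_notMem_spectrumOn : (0 : 𝕜) ∉ spectrumOn 𝕜 a e ↔ IsUnitOn a e := by
  rw [notMem_spectrumOn, zero_smul, sub_zero]

theorem spectrumOn_mono (hae : Commute a e) (hfe : f * e = e) :
    spectrumOn 𝕜 a e ⊆ spectrumOn 𝕜 a f := fun z => mt fun h =>
  h.mono (commute_sub_smul_one hae z).symm hfe

theorem spectrumOn_add_subset :
    spectrumOn 𝕜 a (e + f) ⊆ spectrumOn 𝕜 a e ∪ spectrumOn 𝕜 a f := by
  intro z hz
  by_contra h
  rw [Set.mem_union, not_or] at h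
  exact hz ((notMem_spectrumOn.1 h.1).add (notMem_spectrumOn.1 h.2))

theorem spectrumOn_one : spectrumOn 𝕜 a 1 = spectrum 𝕜 a :=
  Set.ext fun _ => not_iff_comm.1 (isUnit_sub_smul_one_iff.symm.trans isUnitOn_one.symm)

theorem spectrumOn_subset_spectrum (hae : Commute a e) : spectrumOn 𝕜 a e ⊆ spectrum 𝕜 a :=
  (spectrumOn_mono hae (one_mul e)).trans_eq spectrumOn_one

theorem spectrum_subset_union_spectrumOn (a e : R) :
    spectrum 𝕜 a ⊆ spectrumOn 𝕜 a e ∪ spectrumOn 𝕜 a (1 - e) := by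
  rw [← spectrumOn_one, ← add_sub_cancel e 1]
  exact spectrumOn_add_subset.trans_eq (by rw [add_sub_cancel])

theorem mem_spectrum_mul_iff (he : IsIdempotentElem e) (hae : Commute a e) {z : 𝕜} (hz : z ≠ 0) :
    z ∈ spectrum 𝕜 (a * e) ↔ z ∈ spectrumOn 𝕜 a e := by
  have hcomm : Commute (a * e - z • 1) e := commute_sub_smul_one (hae.mul_left (.refl e)) z
  have hcorner : (a * e - z • 1) * e = (a - z • 1) * e := by
    rw [sub_mul, sub_mul, mul_assoc, he.eq]
  have hcorner' : (a * e - z • 1) * (1 - e) = (-z) • 1 * (1 - e) := by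
    rw [sub_mul, mul_assoc, he.mul_one_sub_self, mul_zero, zero_sub, neg_smul, neg_mul]
  rw [← not_iff_not, notMem_spectrumOn, ← isUnit_sub_smul_one_iff]
  constructor
  · intro h
    exact (isUnitOn_of_isUnit h hcomm).congr he (commute_sub_smul_one hae z) hcorner
  · intro h
    exact (h.congr he hcomm hcorner.symm).isUnit ((isUnitOn_smul_one (neg_ne_zero.2 hz) _).congr
      he.one_sub ((Commute.one_right _).sub_right hcomm) hcorner'.symm)

theorem spectrum_mul_eq_spectrumOn (he : IsIdempotentElem e) (hae : Commute a e)
    (h0 : (0 : 𝕜) ∈ spectrumOn 𝕜 a e) : spectrum 𝕜 (a * e) = spectrumOn 𝕜 a e := by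
  ext z
  rcases eq_or_ne z 0 with rfl | hz
  · refine iff_of_true (by_contra fun hu => h0 ?_) h0
    rw [← isUnit_sub_smul_one_iff] at hu
    refine (isUnitOn_of_isUnit hu (commute_sub_smul_one (hae.mul_left (.refl e)) 0)).congr he
      (commute_sub_smul_one hae 0) ?_
    simp only [zero_smul, sub_zero, mul_assoc, he.eq]
  · exact mem_spectrum_mul_iff he hae hz

theorem isUnit_sub_smul_idempotent
    (he : IsIdempotentElem e) (hae : Commute a e) (h : IsUnitOn a (1 - e)) {z : 𝕜}
    (hz : z ∉ spectrumOn 𝕜 a e) : IsUnit (a - z • e) := by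
  have hcomm : Commute (a - z • e) e := hae.sub_left ((Commute.refl e).smul_left z)
  refine ((notMem_spectrumOn.1 hz).congr he hcomm ?_).isUnit
    (h.congr he.one_sub ((Commute.one_right _).sub_right hcomm) ?_)
  · rw [sub_mul, sub_mul, smul_mul_assoc, smul_mul_assoc, one_mul, he.eq]
  · rw [sub_mul, smul_mul_assoc, he.mul_one_sub_self, smul_zero, sub_zero]

theorem spectrumOn_subset_singleton (he : IsIdempotentElem e) (hae : Commute a e) {l : 𝕜} {k : ℕ}
    (hk : (a - l • 1) ^ k * e = 0) : spectrumOn 𝕜 a e ⊆ {l} := by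
  intro z hz
  by_contra hzl
  refine hz ?_
  have hc : Commute (a - l • 1) e := commute_sub_smul_one hae l
  have hnil : IsNilpotent ((a - l • 1) * e) :=
    ⟨k + 1, by rw [hc.mul_pow, he.pow_succ_eq, pow_succ', mul_assoc, hk, mul_zero]⟩
  have hu : IsUnit ((a - l • 1) * e + (l - z) • (1 : R)) :=
    hnil.isUnit_add_right_of_commute
      (isUnitOn_one.1 (isUnitOn_smul_one (sub_ne_zero.2 (Ne.symm hzl)) 1))
      ((Commute.one_right _).smul_right _)
  have hcomm : Commute ((a - l • 1) * e + (l - z) • (1 : R)) e :=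
    (hc.mul_left (.refl e)).add_left ((Commute.one_left e).smul_left _)
  refine (isUnitOn_of_isUnit hu hcomm).congr he (commute_sub_smul_one hae z) ?_
  rw [add_mul, mul_assoc, he.eq, ← add_mul, sub_smul, sub_add_sub_cancel]

/-- The idempotent `e` splits the spectrum of `a` into the part inside `U`, carried by the corner
of `e`, and the part outside `U`, carried by the complementary corner. -/
structure IsSpectralIdempotent (a e : R) (U : Set 𝕜) : Prop where
  idem : IsIdempotentElem e
  commute : Commute a e
  subset : spectrumOn 𝕜 a e ⊆ U
  disjoint : Disjoint (spectrumOn 𝕜 a (1 - e)) U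

namespace IsSpectralIdempotent

variable {U V : Set 𝕜}

theorem commute_one_sub (h : IsSpectralIdempotent a e U) : Commute a (1 - e) :=
  (Commute.one_right a).sub_right h.commute

theorem spectrumOn_eq (h : IsSpectralIdempotent a e U) :
    spectrumOn 𝕜 a e = spectrum 𝕜 a ∩ U := by
  refine (Set.subset_inter (spectrumOn_subset_spectrum h.commute) h.subset).antisymm ?_
  rintro z ⟨hz, hzU⟩
  exact (spectrum_subset_union_spectrumOn a e hz).resolve_right
    fun hz' => h.disjoint.notMem_of_mem_left hz' hzU

theorem spectrumOn_one_sub_eq (h : IsSpectralIdempotent a e U) :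
    spectrumOn 𝕜 a (1 - e) = spectrum 𝕜 a \ U := by
  refine Set.Subset.antisymm (fun z hz =>
    ⟨spectrumOn_subset_spectrum h.commute_one_sub hz, h.disjoint.notMem_of_mem_left hz⟩) ?_
  rintro z ⟨hz, hzU⟩
  exact (spectrum_subset_union_spectrumOn a e hz).resolve_left fun hz' => hzU (h.subset hz')

theorem zero (a : R) : IsSpectralIdempotent a 0 (∅ : Set 𝕜) where
  idem := .zero
  commute := .zero_right a
  subset := fun _ hz => hz ⟨0, mul_zero _, zero_mul _⟩
  disjoint := Set.disjoint_empty _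

theorem union (he : IsSpectralIdempotent a e U) (hf : IsSpectralIdempotent a f V)
    (hef : Commute e f) : IsSpectralIdempotent a (1 - (1 - e) * (1 - f)) (U ∪ V) := by
  have hef' : Commute (1 - e) (1 - f) :=
    (Commute.one_left _).sub_left ((Commute.one_right e).sub_right hef)
  have hcomm : Commute a ((1 - e) * (1 - f)) := he.commute_one_sub.mul_right hf.commute_one_sub
  refine ⟨(he.idem.one_sub.mul_of_commute hef' hf.idem.one_sub).one_sub,
    (Commute.one_right a).sub_right hcomm, ?_, ?_⟩
  · have hsum : 1 - (1 - e) * (1 - f) = e + f * (1 - e) := by rw [hef'.eq]; noncomm_ring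
    rw [hsum]
    exact spectrumOn_add_subset.trans (Set.union_subset_union he.subset
      ((spectrumOn_mono (hf.commute.mul_right he.commute_one_sub)
        (by rw [← mul_assoc, hf.idem.eq])).trans hf.subset))
  · rw [sub_sub_cancel, Set.disjoint_union_right]
    exact ⟨he.disjoint.mono_left (spectrumOn_mono hcomm (by rw [← mul_assoc, he.idem.one_sub.eq])),
      hf.disjoint.mono_left (spectrumOn_mono hcomm
        (by rw [hef'.eq, ← mul_assoc, hf.idem.one_sub.eq]))⟩

end IsSpectralIdempotent

end SpectrumOn

section NormedAlgebra

variable {𝕜 R : Type*} [NormedField 𝕜] [NormedRing R] [NormedAlgebra 𝕜 R] [CompleteSpace R]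
  {a e : R}

theorem isClosed_spectrumOn (he : IsIdempotentElem e) (hae : Commute a e) :
    IsClosed (spectrumOn 𝕜 a e) := by
  have hpre : (spectrumOn 𝕜 a e)ᶜ =
      (fun z : 𝕜 => (a - z • 1) * e + (1 - e)) ⁻¹' {u | IsUnit u} := Set.ext fun z =>
    notMem_spectrumOn.trans (isUnitOn_iff_isUnit_add he (commute_sub_smul_one hae z))
  rw [← isOpen_compl_iff, hpre]
  exact Units.isOpen.preimage (by fun_prop)

theorem isCompact_spectrumOn [ProperSpace 𝕜] (he : IsIdempotentElem e) (hae : Commute a e) :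
    IsCompact (spectrumOn 𝕜 a e) :=
  (spectrum.isCompact a).of_isClosed_subset (isClosed_spectrumOn he hae)
    (spectrumOn_subset_spectrum hae)

end NormedAlgebra

/-! ### Everywhere defined operators -/

section Algebraic

variable {E : Type*} [AddCommGroup E] [Module ℂ E] {f g : E →ₗ[ℂ] E}

theorem linearPMap_ext_of_domain_eq_top {A B : E →ₗ.[ℂ] E} (hA : A.domain = ⊤)
    (hB : B.domain = ⊤) (h : ∀ x (hx : x ∈ A.domain) (hx' : x ∈ B.domain), A ⟨x, hx⟩ = B ⟨x, hx'⟩) :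
    A = B :=
  LinearPMap.ext (hA.trans hB.symm) fun x hx hx' => h x hx hx'

theorem mem_graph_ofMap {x y : E} : 
    (x, y) ∈ (ofMap f).graph ↔ f x = y := by
  refine (LinearPMap.mem_graph_iff _).trans ⟨?_, fun h => ⟨⟨x, trivial⟩, rfl, h⟩⟩
  rintro ⟨w, rfl, h⟩
  exact h

theorem subMap_ofMap (f g : E →ₗ[ℂ] E) : subMap (ofMap f) g = ofMap (f - g) :=
  linearPMap_ext_of_domain_eq_top rfl rfl fun _ _ _ => rfl

theorem shift_ofMap (f : E →ₗ[ℂ] E) (z : ℂ) : shift (ofMap f) z = ofMap (f - z • LinearMap.id) :=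
  subMap_ofMap _ _

theorem pcomp_ofMap (f g : E →ₗ[ℂ] E) : pcomp (ofMap f) (ofMap g) = ofMap (f ∘ₗ g) :=
  linearPMap_ext_of_domain_eq_top (by ext x; exact ⟨fun _ => trivial, fun _ => ⟨trivial, trivial⟩⟩)
    rfl fun _ _ _ => rfl

theorem pow_ofMap (f : E →ₗ[ℂ] E) (n : ℕ) : pow (ofMap f) n = ofMap (f ^ n) := by
  induction n with
  | zero => rfl
  | succ n ih => rw [pow, ih, pcomp_ofMap, pow_succ']; rfl

theorem nullSpace_ofMap (f : E →ₗ[ℂ] E) : nullSpace (ofMap f) = LinearMap.ker f := by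
  ext x
  refine ⟨?_, fun h => ⟨⟨x, trivial⟩, h, rfl⟩⟩
  rintro ⟨y, hy, rfl⟩
  exact hy

theorem ran_ofMap (f : E →ₗ[ℂ] E) : ran (ofMap f) = LinearMap.range f :=
  SetLike.coe_injective ((Equiv.Set.univ E).surjective.range_comp f)

theorem bijective_toFun_ofMap : Function.Bijective (ofMap f).toFun ↔ Function.Bijective f :=
  Function.Bijective.of_comp_iff f
    (g := (⊤ : Submodule ℂ E).subtype) (Equiv.Set.univ E).bijective

theorem part_ofMap {N : Submodule ℂ E} (h : ∀ x ∈ N, f x ∈ N) :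
    part (ofMap f) N = ofMap (f.restrict h) :=
  linearPMap_ext_of_domain_eq_top (eq_top_iff.2 fun x _ => ⟨trivial, h x x.2⟩) rfl fun _ _ _ => rfl

theorem mem_spec_ofMap {z : ℂ} :
    z ∈ spec (ofMap f) ↔ ¬ Function.Bijective (f - z • LinearMap.id : E →ₗ[ℂ] E) := by
  rw [← bijective_toFun_ofMap, ← shift_ofMap]
  rfl

end Algebraic

section Corner

variable {𝕜 X : Type*} [NontriviallyNormedField 𝕜] [NormedAddCommGroup X] [NormedSpace 𝕜 X]
  [CompleteSpace X] {c e : X →L[𝕜] X}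

theorem isUnitOn_iff_bijOn (he : IsIdempotentElem e) (hce : Commute c e) :
    IsUnitOn c e ↔ Set.BijOn c e.range e.range := by
  have hmem {x : X} : x ∈ e.range ↔ e x = x :=
    LinearMap.IsIdempotentElem.mem_range_iff (ContinuousLinearMap.IsIdempotentElem.toLinearMap he)
  have hcex (x : X) : c (e x) = e (c x) := congr($hce.eq x)
  have hidem (x : X) : e (e x) = e x := congr($he.eq x)
  constructor
  · rintro ⟨d, hcd, hdc⟩
    have hcdx (x : X) : c (d x) = e x := congr($hcd x)
    have hdcx (x : X) : d (c x) = e x := congr($hdc x)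
    refine ⟨fun x hx => hmem.2 ?_, fun x hx y hy hxy => ?_, fun y hy => ⟨e (d y), ⟨d y, rfl⟩, ?_⟩⟩
    · rw [← hcex, hmem.1 hx]
    · rw [← hmem.1 hx, ← hmem.1 hy, ← hdcx, ← hdcx, hxy]
    · rw [hcex, hcdx, hidem, hmem.1 hy]
  · rintro ⟨-, hinj, hsurj⟩
    rw [isUnitOn_iff_isUnit_add he hce, ContinuousLinearMap.isUnit_iff_bijective]
    have happly (x : X) : (c * e + (1 - e)) x = c (e x) + (x - e x) := rfl
    refine ⟨(injective_iff_map_eq_zero _).2 fun x hx => ?_, fun y => ?_⟩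
    · have hcx : c (e x) = 0 := by
        have := congr(e $hx)
        rwa [happly, map_add, map_sub, hidem, sub_self, add_zero, ← hcex, hidem, map_zero] at this
      have hex : e x = 0 := hinj ⟨x, rfl⟩ (zero_mem e.range) (hcx.trans (map_zero c).symm)
      rwa [happly, hex, map_zero, zero_add, sub_zero] at hx
    · obtain ⟨w, hw, hwy⟩ := hsurj ⟨y, rfl⟩
      refine ⟨w + (y - e y), ?_⟩
      rw [happly, map_add, map_sub, hmem.1 hw, hidem, sub_self, add_zero, hwy,
        ContinuousLinearMap.coe_coe, add_sub_cancel_left, add_sub_cancel]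

end Corner

section Spectrum

variable {X : Type*} [NormedAddCommGroup X] [NormedSpace ℂ X]

theorem shift_ofMap_coe (a : X →L[ℂ] X) (z : ℂ) :
    shift (ofMap (a : X →ₗ[ℂ] X)) z = ofMap ((a - z • 1 : X →L[ℂ] X) : X →ₗ[ℂ] X) :=
  shift_ofMap _ _

theorem mulBdd_ofMap (a b : X →L[ℂ] X) :
    mulBdd (ofMap (a : X →ₗ[ℂ] X)) b = ofMap ((a * b : X →L[ℂ] X) : X →ₗ[ℂ] X) :=
  pcomp_ofMap _ _

variable [CompleteSpace X] {a e : X →L[ℂ] X}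

theorem spec_ofMap (a : X →L[ℂ] X) : spec (ofMap (a : X →ₗ[ℂ] X)) = spectrum ℂ a := by
  ext z
  rw [mem_spec_ofMap, not_iff_comm, ← isUnit_sub_smul_one_iff,
    ContinuousLinearMap.isUnit_iff_bijective]
  rfl

theorem spec_part_ofMap (he : IsIdempotentElem e) (hae : Commute a e) :
    spec (part (ofMap (a : X →ₗ[ℂ] X)) e.range) = spectrumOn ℂ a e := by
  have hinv (c : X →L[ℂ] X) (hce : Commute c e) : Set.MapsTo c e.range e.range := by
    rintro _ ⟨x, rfl⟩
    exact ⟨c x, congr($hce.eq x).symm⟩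
  ext z
  have hz := commute_sub_smul_one hae z
  rw [part_ofMap (hinv a hae), mem_spec_ofMap, not_iff_comm, notMem_spectrumOn,
    isUnitOn_iff_bijOn he hz]
  have hmaps := hinv _ hz
  exact ⟨fun h => h.bijective,
    fun h => ⟨hmaps, hmaps.restrict_inj.1 h.1, hmaps.restrict_surjective_iff.1 h.2⟩⟩

end Spectrum

/-! ### Fredholm operators -/

section Fredholm

open scoped LinearMap.FiniteRangeSetoid

variable {X : Type*} [NormedAddCommGroup X]

theorem isFredholm_pow {𝕜 : Type*} [NontriviallyNormedField 𝕜] [CompleteSpace 𝕜]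
    [NormedSpace 𝕜 X] {f : X →L[𝕜] X} (hf : f.IsFredholm) (n : ℕ) : (f ^ n).IsFredholm := by
  obtain ⟨v, hv⟩ := hf.exists_isQuasiInverse
  suffices h : (v ^ n).toLinearMap.IsQuasiInverse (f ^ n).toLinearMap from .of_isQuasiInverse h
  induction n with
  | zero => exact (LinearEquiv.refl 𝕜 X).isQuasiInverse
  | succ n ih => rw [pow_succ v, pow_succ' f]; exact ih.comp hv

variable [NormedSpace ℂ X] {f u : X →L[ℂ] X}

theorem isFredholm_ofMap_iff_closed_finite : IsFredholm (ofMap (f : X →ₗ[ℂ] X)) ↔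
    IsClosed (f.range : Set X) ∧ FiniteDimensional ℂ f.ker ∧ FiniteDimensional ℂ (X ⧸ f.range) := by
  rw [IsFredholm, nullSpace_ofMap, ran_ofMap]

theorem isFredholm_ofMap_of_mul {v w : X →L[ℂ] X}
    (huv : IsFredholm (ofMap ((u * v : X →L[ℂ] X) : X →ₗ[ℂ] X)))
    (hwu : IsFredholm (ofMap ((w * u : X →L[ℂ] X) : X →ₗ[ℂ] X))) :
    IsFredholm (ofMap (u : X →ₗ[ℂ] X)) := by
  rw [isFredholm_ofMap_iff_closed_finite] at *
  obtain ⟨hclosed, -, hcoker⟩ := huv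
  have hran : (u * v).range ≤ u.range := LinearMap.range_comp_le_range _ _
  have hker : u.ker ≤ (w * u).ker := LinearMap.ker_le_ker_comp _ _
  have := hwu.2.1
  exact ⟨Submodule.isClosed_mono_of_finiteDimensional_quotient hclosed hran,
    Submodule.finiteDimensional_of_le hker,
    Module.Finite.of_surjective (Submodule.factor hran) (Submodule.factor_surjective hran)⟩

theorem isFredholm_ofMap_of_isUnit (hf : IsUnit f) : IsFredholm (ofMap (f : X →ₗ[ℂ] X)) := by
  have h1 : IsFredholm (ofMap ((1 : X →L[ℂ] X) : X →ₗ[ℂ] X)) := by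
    rw [isFredholm_ofMap_iff_closed_finite]
    have hker : (1 : X →L[ℂ] X).ker = ⊥ := LinearMap.ker_id
    have hran : (1 : X →L[ℂ] X).range = ⊤ := LinearMap.range_id
    rw [hker, hran]
    exact ⟨isClosed_univ, inferInstance, inferInstance⟩
  obtain ⟨v, hfv, hvf⟩ := isUnit_iff_exists.1 hf
  exact isFredholm_ofMap_of_mul (v := v) (w := v) (by rwa [hfv]) (by rwa [hvf])

theorem isFredholm_ofMap_mul_sub {a e : X →L[ℂ] X} (he : IsIdempotentElem e) (hae : Commute a e)
    {z : ℂ} (hz : z ≠ 0)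
    (h : IsFredholm (ofMap ((a - z • 1 : X →L[ℂ] X) : X →ₗ[ℂ] X))) :
    IsFredholm (ofMap ((a * e - z • 1 : X →L[ℂ] X) : X →ₗ[ℂ] X)) := by
  have hc : Commute (a * e - z • 1) e := commute_sub_smul_one (hae.mul_left (.refl e)) z
  have hc' : Commute (a * e - z • 1) (a - z • 1) := commute_sub_smul_one
    (commute_sub_smul_one ((Commute.refl a).mul_right hae) z).symm z
  have hcomm : Commute (a * e - z • 1) (e - z⁻¹ • ((a - z • 1) * (1 - e))) :=
    hc.sub_right ((hc'.mul_right ((Commute.one_right _).sub_right hc)).smul_right _)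
  have hcorner : (a * e - z • 1) * e = (a - z • 1) * e := by
    rw [sub_mul, sub_mul, mul_assoc, he.eq]
  have hcorner' : (a * e - z • 1) * (1 - e) = -z • (1 - e) := by
    rw [sub_mul, mul_assoc, he.mul_one_sub_self, mul_zero, zero_sub, smul_mul_assoc, one_mul,
      neg_smul]
  have hmul : (a * e - z • 1) * (e - z⁻¹ • ((a - z • 1) * (1 - e))) = a - z • 1 := by
    rw [mul_sub, hcorner, mul_smul_comm, ← mul_assoc, hc'.eq, mul_assoc, hcorner',
      mul_smul_comm, smul_smul, mul_neg, inv_mul_cancel₀ hz, neg_one_smul, sub_neg_eq_add,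
      ← mul_add, add_sub_cancel, mul_one]
  exact isFredholm_ofMap_of_mul (hmul ▸ h) ((hcomm.eq.symm.trans hmul) ▸ h)

variable [CompleteSpace X]

theorem isFredholm_ofMap : IsFredholm (ofMap (f : X →ₗ[ℂ] X)) ↔ f.IsFredholm := by
  rw [isFredholm_ofMap_iff_closed_finite]
  refine ⟨fun ⟨hran, hker, hcoker⟩ => ⟨?_, hran, hker, hcoker, .of_finiteDimensional _⟩,
    fun h => ⟨h.isClosed_range, h.finite_ker, h.finite_coker⟩⟩
  have := hran.completeSpace_coe
  let g : X →L[ℂ] f.range := f.codRestrict f.range fun x => ⟨x, rfl⟩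
  have hsurj : Function.Surjective g := LinearMap.surjective_rangeRestrict _
  exact LinearMap.isStrictMap_iff_isOpenQuotientMap_rangeRestrict.2
    ⟨hsurj, g.continuous, g.isOpenMap hsurj⟩

end Fredholm

/-! ### Ascent, descent and Browder points -/

section AscentDescent

variable {K E : Type*} [Field K] [AddCommGroup E] [Module K E] {f : Module.End K E}

theorem range_pow_constant {m : ℕ} (h : (f ^ m).range = (f ^ (m + 1)).range) (j : ℕ) :
    (f ^ m).range = (f ^ (m + j)).range := by
  induction j with
  | zero => rfl
  | succ j ih =>
    have hmap (i : ℕ) : (f ^ (m + i + 1)).range = (f ^ (m + i)).range.map f := by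
      rw [pow_succ', Module.End.mul_eq_comp, LinearMap.range_comp]
    rw [← add_assoc, hmap, ← ih]
    exact h.trans (hmap 0)

theorem exists_bijOn_range_pow {n m : ℕ} (hker : (f ^ n).ker = (f ^ (n + 1)).ker)
    (hran : (f ^ m).range = (f ^ (m + 1)).range) :
    ∃ k, Set.BijOn f (f ^ k).range (f ^ k).range := by
  have hker' : (f ^ (n + m)).ker = (f ^ (n + m + 1)).ker :=
    (Module.End.ker_pow_constant hker m).symm.trans (Module.End.ker_pow_constant hker (m + 1))
  have hran' : (f ^ (n + m)).range = (f ^ (n + m + 1)).range := by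
    rw [add_comm n m, add_assoc, ← range_pow_constant hran, ← range_pow_constant hran]
  have hpow (x : E) : f ((f ^ (n + m)) x) = (f ^ (n + m + 1)) x := by rw [pow_succ']; rfl
  refine ⟨n + m, ?_, ?_, ?_⟩
  · rintro _ ⟨x, rfl⟩
    exact hran' ▸ ⟨x, (hpow x).symm⟩
  · rintro _ ⟨x, rfl⟩ _ ⟨y, rfl⟩ hxy
    rw [← sub_eq_zero, ← map_sub, ← map_sub, hpow] at hxy
    rw [← sub_eq_zero, ← map_sub]
    exact hker'.ge hxy
  · intro y hy
    obtain ⟨x, rfl⟩ := hran'.le hy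
    exact ⟨(f ^ (n + m)) x, ⟨x, rfl⟩, hpow x⟩

theorem isCompl_ker_range_of_bijOn (h : Set.BijOn f f.range f.range) :
    IsCompl f.ker f.range := by
  refine ⟨Submodule.disjoint_def.2 fun x hker hran => h.injOn hran f.range.zero_mem
    (hker.trans f.map_zero.symm), codisjoint_iff.2 (eq_top_iff.2 fun x _ => ?_)⟩
  obtain ⟨y, hy, hyx⟩ := h.surjOn ⟨x, rfl⟩
  exact Submodule.mem_sup.2
    ⟨x - y, by rw [LinearMap.mem_ker, map_sub, hyx, sub_self], y, hy, sub_add_cancel x y⟩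

end AscentDescent

section Browder

variable {X : Type*} [NormedAddCommGroup X] [CompleteSpace X]

theorem exists_idempotent_of_bijOn_range_pow {𝕜 : Type*} [NontriviallyNormedField 𝕜]
    [NormedSpace 𝕜 X] {s : X →L[𝕜] X} {k : ℕ} (hbij : Set.BijOn s (s ^ k).range (s ^ k).range)
    (hclosed : IsClosed ((s ^ k).range : Set X)) :
    ∃ e : X →L[𝕜] X, IsIdempotentElem e ∧ (∀ b, Commute s b → Commute e b) ∧
      s ^ k * e = 0 ∧ IsUnitOn s (1 - e) := by
  have hbij' : Set.BijOn (s ^ k) (s ^ k).range (s ^ k).range := by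
    simpa only [FunLike.coe_pow_eq_iterate] using hbij.iterate k
  have hcompl : (s ^ k).ker.IsTopCompl (s ^ k).range :=
    Submodule.IsCompl.isTopCompl_of_isClosed (isCompl_ker_range_of_bijOn hbij')
      (s ^ k).isClosed_ker hclosed
  let e := (s ^ k).ker.projectionL (s ^ k).range hcompl
  have he : IsIdempotentElem e := Submodule.isIdempotentElem_projectionL hcompl
  have hran : e.range = (s ^ k).ker := Submodule.range_projectionL hcompl
  have hker : e.ker = (s ^ k).range := Submodule.ker_projectionL hcompl
  have hcomm (b : X →L[𝕜] X) (hb : Commute s b) : Commute e b := by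
    have hbx (x : X) : (s ^ k) (b x) = b ((s ^ k) x) := congr($((hb.pow_left k).eq) x)
    rw [ContinuousLinearMap.IsIdempotentElem.commute_iff he, hran, hker]
    refine ⟨fun x hx => ?_, ?_⟩
    · exact (hbx x).trans ((congrArg b hx).trans b.map_zero)
    · rintro _ ⟨x, rfl⟩
      exact ⟨b x, hbx x⟩
  refine ⟨e, he, hcomm, ?_, ?_⟩
  · ext x
    exact Submodule.projectionL_apply_mem hcompl x
  · have hran' : (1 - e).range = (s ^ k).range := (LinearMap.IsIdempotentElem.ker_eq_range_one_sub
      (ContinuousLinearMap.IsIdempotentElem.toLinearMap he)).symm.trans hker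
    rw [isUnitOn_iff_bijOn he.one_sub ((Commute.one_right s).sub_right (hcomm s (.refl s)).symm),
      hran']
    exact hbij

variable [NormedSpace ℂ X]

theorem exists_isSpectralIdempotent_singleton {a : X →L[ℂ] X} {l : ℂ}
    (h : IsBrowder (shift (ofMap (a : X →ₗ[ℂ] X)) l)) :
    ∃ e, IsSpectralIdempotent a e {l} ∧ ∀ b, Commute a b → Commute e b := by
  obtain ⟨hfred, ⟨n, hker⟩, m, hran⟩ := h
  rw [shift_ofMap_coe] at hfred hker hran
  simp only [pow_ofMap, nullSpace_ofMap, ran_ofMap] at hker hran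
  obtain ⟨k, hk⟩ := exists_bijOn_range_pow hker hran
  obtain ⟨e, he, hcomm, hpow, hunit⟩ := exists_idempotent_of_bijOn_range_pow (k := k)
    (by rw [ContinuousLinearMap.toLinearMap_pow]; exact hk)
    (isFredholm_pow (isFredholm_ofMap.1 hfred) k).isClosed_range
  have hcomm' (b : X →L[ℂ] X) (hb : Commute a b) : Commute e b :=
    hcomm b (commute_sub_smul_one hb l)
  have hae : Commute a e := (hcomm' a (.refl a)).symm
  exact ⟨e, ⟨he, hae, spectrumOn_subset_singleton he hae hpow,
    Set.disjoint_singleton_right.2 (notMem_spectrumOn.2 hunit)⟩, hcomm'⟩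

theorem exists_isSpectralIdempotent_finset {a : X →L[ℂ] X} (F : Finset ℂ)
    (h : ∀ l ∈ F, IsBrowder (shift (ofMap (a : X →ₗ[ℂ] X)) l)) :
    ∃ e, IsSpectralIdempotent a e (F : Set ℂ) ∧ ∀ b, Commute a b → Commute e b := by
  induction F using Finset.induction_on with
  | empty => exact ⟨0, by simpa using .zero a, fun b _ => .zero_left b⟩
  | insert l F _ ih =>
    rw [Finset.forall_mem_insert] at h
    obtain ⟨e, he, hecomm⟩ := exists_isSpectralIdempotent_singleton h.1
    obtain ⟨f, hf, hfcomm⟩ := ih h.2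
    refine ⟨_, by simpa using he.union hf (hecomm f hf.commute), fun b hb => ?_⟩
    exact (Commute.one_left b).sub_left (((Commute.one_left b).sub_left (hecomm b hb)).mul_left
      ((Commute.one_left b).sub_left (hfcomm b hb)))

theorem eventually_notMem_spectrum_of_isBrowder {a : X →L[ℂ] X} {l : ℂ}
    (h : IsBrowder (shift (ofMap (a : X →ₗ[ℂ] X)) l)) : ∀ᶠ z in 𝓝[≠] l, z ∉ spectrum ℂ a := by
  obtain ⟨e, he, -⟩ := exists_isSpectralIdempotent_singleton h
  have hopen : ∀ᶠ z in 𝓝 l, z ∉ spectrumOn ℂ a (1 - e) :=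
    (isClosed_spectrumOn he.idem.one_sub he.commute_one_sub).isOpen_compl.mem_nhds
      (Set.disjoint_singleton_right.1 he.disjoint)
  filter_upwards [hopen.filter_mono nhdsWithin_le_nhds, self_mem_nhdsWithin] with z hz hzl hmem
  exact (spectrum_subset_union_spectrumOn a e hmem).elim (fun h => hzl (he.subset h)) hz

end Browder

/-! ### Fredholm alternative and Riesz operators -/

section FredholmAlternative

open scoped LinearMap.FiniteRangeSetoid

theorem isUnit_one_add_comp_of_swap {R E F : Type*} [Ring R] [AddCommGroup E] [AddCommGroup F]
    [Module R E] [Module R F] {A : F →ₗ[R] E} {B : E →ₗ[R] F}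
    (h : IsUnit (1 + A ∘ₗ B : Module.End R E)) : IsUnit (1 + B ∘ₗ A : Module.End R F) := by
  obtain ⟨d, hd, hd'⟩ := isUnit_iff_exists.1 h
  have hdx (x : E) : d x + A (B (d x)) = x := congr($hd x)
  have hdx' (x : E) : d (x + A (B x)) = x := congr($hd' x)
  refine isUnit_iff_exists.2 ⟨1 - B ∘ₗ d ∘ₗ A, LinearMap.ext fun y => ?_, LinearMap.ext fun y => ?_⟩
  · have := congr(B $(hdx (A y)))
    simp only [Module.End.mul_apply, LinearMap.add_apply, LinearMap.sub_apply, Module.End.one_apply,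
      LinearMap.comp_apply, map_sub, map_add] at this ⊢
    rw [← this]
    abel
  · have := congr(B $(hdx' (A y)))
    simp only [Module.End.mul_apply, LinearMap.add_apply, LinearMap.sub_apply, Module.End.one_apply,
      LinearMap.comp_apply, map_add] at this ⊢
    rw [← eq_sub_of_add_eq this, sub_add_cancel]

theorem analyticAt_det {𝕜 V : Type*} [NontriviallyNormedField 𝕜] [CompleteSpace 𝕜]
    [NormedAddCommGroup V] [NormedSpace 𝕜 V] [FiniteDimensional 𝕜 V] {u : 𝕜 → V →L[𝕜] V} {z : 𝕜}
    (hu : AnalyticAt 𝕜 u z) : AnalyticAt 𝕜 (fun w => (u w).det) z := by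
  let b := Module.finBasis 𝕜 V
  have hentry (i j) : AnalyticAt 𝕜 (fun w => LinearMap.toMatrix b b (u w) i j) z := by
    simp only [LinearMap.toMatrix_apply]
    exact ((LinearMap.toContinuousLinearMap (b.coord i)).analyticAt _).comp
      ((ContinuousLinearMap.apply 𝕜 V (b j)).analyticAt _ |>.comp hu)
  simp only [ContinuousLinearMap.det, ← LinearMap.det_toMatrix b, Matrix.det_apply']
  exact Finset.analyticAt_fun_sum _ fun σ _ =>
    analyticAt_const.mul (Finset.analyticAt_fun_prod _ fun i _ => hentry _ _)

variable {X : Type*} [NormedAddCommGroup X] [NormedSpace ℂ X] [CompleteSpace X]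

theorem eventually_isUnit_sub_smul (g v : X →L[ℂ] X) (hg : IsUnit g) :
    ∀ᶠ z : ℂ in 𝓝 0, IsUnit (g - z • v) :=
  (Units.isOpen.preimage (by fun_prop : Continuous fun z : ℂ => g - z • v)).mem_nhds (by simpa)

theorem exists_isUnit_equiv_of_frequently_isUnit {f : X →L[ℂ] X} (hf : f.IsFredholm)
    (h : ∃ᶠ z : ℂ in 𝓝 0, IsUnit (f - z • 1)) :
    ∃ g : X →L[ℂ] X, IsUnit g ∧ (f - g).toLinearMap.HasFiniteRange := by
  obtain ⟨v, hv⟩ := hf.exists_isQuasiInverse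
  obtain ⟨z, ⟨u, hu⟩, ⟨w, hw⟩⟩ :=
    (h.and_eventually (eventually_isUnit_sub_smul 1 v isUnit_one)).exists
  refine ⟨↑(w⁻¹ * u), (w⁻¹ * u).isUnit, ?_⟩
  have hvf : (1 - v * f).toLinearMap.HasFiniteRange :=
    LinearMap.FiniteRangeSetoid.equiv_iff_hasFiniteRange.1 (Setoid.symm hv.1)
  have hdiff : f - ↑(w⁻¹ * u) = z • (↑w⁻¹ * (1 - v * f)) := by
    have hw' : w * (z • (↑w⁻¹ * (1 - v * f))) = w * f - u := by
      rw [← mul_smul_comm, w.mul_inv_cancel_left, hu, hw, sub_mul, one_mul, smul_mul_assoc,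
        smul_sub]
      abel
    rw [← w.inv_mul_cancel_left (z • _), hw', mul_sub, w.inv_mul_cancel_left, Units.val_mul]
  rw [hdiff]
  exact (hvf.comp_left _).smul z

theorem eventually_isUnit_sub_of_frequently {f : X →L[ℂ] X} (hf : f.IsFredholm)
    (h : ∃ᶠ z : ℂ in 𝓝[≠] 0, IsUnit (f - z • 1)) : ∀ᶠ z : ℂ in 𝓝[≠] 0, IsUnit (f - z • 1) := by
  obtain ⟨g, hg, hfin⟩ :=
    exists_isUnit_equiv_of_frequently_isUnit hf (h.filter_mono nhdsWithin_le_nhds)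
  let V := (f - g).range
  have : FiniteDimensional ℂ V := Module.Finite.iff_fg.2 (LinearMap.hasFiniteRange_iff_range.1 hfin)
  let k : X →L[ℂ] V := (f - g).codRestrict V fun x => ⟨x, rfl⟩
  let u : ℂ → V →L[ℂ] V := fun z => 1 + k.comp ((Ring.inverse (g - z • 1)).comp V.subtypeL)
  have hg' := eventually_isUnit_sub_smul g 1 hg
  have hdet {z : ℂ} (hz : IsUnit (g - z • 1)) : IsUnit (f - z • 1) ↔ (u z).det ≠ 0 := by
    have hfac : f - z • 1 = (g - z • 1) * (1 + (Ring.inverse (g - z • 1) ∘L V.subtypeL) ∘L k) := by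
      have hk : f - g = V.subtypeL ∘L k := rfl
      rw [mul_add, mul_one, ContinuousLinearMap.comp_assoc, ← hk, ← ContinuousLinearMap.mul_def,
        Ring.mul_inverse_cancel_left _ _ hz]
      abel
    rw [hfac, ← hz.unit_spec, Units.isUnit_units_mul, ContinuousLinearMap.isUnit_iff_bijective,
      ← isUnit_iff_ne_zero]
    exact (Module.End.isUnit_iff _).symm.trans
      (Iff.trans ⟨isUnit_one_add_comp_of_swap, isUnit_one_add_comp_of_swap⟩
        (LinearMap.isUnit_iff_isUnit_det _))
  have han : AnalyticAt ℂ (fun z => (u z).det) 0 := by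
    have hinv : AnalyticAt ℂ (fun z : ℂ => Ring.inverse (g - z • 1)) 0 := by
      refine AnalyticAt.fun_comp (g := Ring.inverse) ?_ (by fun_prop)
      obtain ⟨w, rfl⟩ := hg
      simpa using analyticAt_inverse w
    exact analyticAt_det (analyticAt_const.add
      (((ContinuousLinearMap.compL ℂ V X V k).analyticAt _).comp
        ((((ContinuousLinearMap.compL ℂ V X X).flip V.subtypeL).analyticAt _).comp hinv)))
  rcases han.eventually_eq_zero_or_eventually_ne_zero with h0 | h0
  · refine absurd ?_ h
    filter_upwards [h0.filter_mono nhdsWithin_le_nhds, hg'.filter_mono nhdsWithin_le_nhds]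
      with z hz hgz
    rwa [hdet hgz, not_not]
  · filter_upwards [h0, hg'.filter_mono nhdsWithin_le_nhds] with z hz hgz
    exact (hdet hgz).2 hz

end FredholmAlternative

section RieszPart

theorem frequently_notMem_of_eventually_isolated {Y : Type*} [TopologicalSpace Y] [T1Space Y]
    [∀ y : Y, (𝓝[≠] y).NeBot] {s : Set Y} {x : Y}
    (h : ∀ᶠ y in 𝓝[≠] x, y ∈ s → ∀ᶠ w in 𝓝[≠] y, w ∉ s) : ∃ᶠ y in 𝓝[≠] x, y ∉ s := by
  intro hnot
  simp only [not_not] at hnot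
  obtain ⟨y, ⟨hisol, hy⟩, hynear⟩ :=
    ((h.and hnot).and (eventually_nhdsNE_eventually_nhds_iff.2 hnot)).exists
  obtain ⟨w, hw, hw'⟩ := ((hisol hy).and (hynear.filter_mono nhdsWithin_le_nhds)).exists
  exact hw hw'

variable {X : Type*} [NormedAddCommGroup X] [NormedSpace ℂ X] [CompleteSpace X] {a P Q : X →L[ℂ] X}

theorem eventually_notMem_spectrum_mul (hQ : IsIdempotentElem Q) (haQ : Commute a Q) {z : ℂ}
    (hz : z ≠ 0) (h : IsBrowder (shift (ofMap (a : X →ₗ[ℂ] X)) z)) :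
    ∀ᶠ w in 𝓝[≠] z, w ∉ spectrum ℂ (a * Q) := by
  filter_upwards [eventually_notMem_spectrum_of_isBrowder h,
    nhdsWithin_le_nhds (isOpen_compl_singleton.mem_nhds hz)] with w hw hw0 hwQ
  exact hw (spectrumOn_subset_spectrum haQ ((mem_spectrum_mul_iff hQ haQ hw0).1 hwQ))

theorem isRiesz_mul (hQ : IsIdempotentElem Q) (haQ : Commute a Q)
    (hbr : ∀ z ∈ spectrumOn ℂ a Q, z ≠ 0 → IsBrowder (shift (ofMap (a : X →ₗ[ℂ] X)) z))
    (hacc : AccPt 0 (𝓟 (spectrumOn ℂ a Q))) : IsRiesz (a * Q) := by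
  have hnonzero {z : ℂ} (hz : z ≠ 0) : IsFredholm (ofMap (a * Q - z • 1).toLinearMap) := by
    by_cases hzQ : z ∈ spectrumOn ℂ a Q
    · exact isFredholm_ofMap_mul_sub hQ haQ hz (shift_ofMap_coe a z ▸ (hbr z hzQ hz).1)
    · exact isFredholm_ofMap_of_isUnit
        (isUnit_sub_smul_one_iff.2 (mt (mem_spectrum_mul_iff hQ haQ hz).1 hzQ))
  have hfreq : ∃ᶠ z : ℂ in 𝓝[≠] 0, z ∈ spectrum ℂ (a * Q) :=
    ((accPt_iff_frequently_nhdsNE.1 hacc).and_eventually self_mem_nhdsWithin).mono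
      fun z hz => (mem_spectrum_mul_iff hQ haQ hz.2).2 hz.1
  have hunits : ∃ᶠ z : ℂ in 𝓝[≠] 0, IsUnit (a * Q - z • 1) := by
    simp only [isUnit_sub_smul_one_iff]
    refine frequently_notMem_of_eventually_isolated ?_
    filter_upwards [self_mem_nhdsWithin] with z hz hzQ
    exact eventually_notMem_spectrum_mul hQ haQ hz
      (hbr z ((mem_spectrum_mul_iff hQ haQ hz).1 hzQ) hz)
  have hzero : ¬IsFredholm (ofMap (a * Q : X →L[ℂ] X).toLinearMap) := fun hfred => hfreq <|
    (eventually_isUnit_sub_of_frequently (isFredholm_ofMap.1 hfred) hunits).mono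
      fun z hz => isUnit_sub_smul_one_iff.1 hz
  ext z
  rw [essSpec, Set.mem_ofPred_eq, shift_ofMap_coe]
  rcases eq_or_ne z 0 with rfl | hz
  · rw [zero_smul, sub_zero]
    exact iff_of_true hzero rfl
  · exact iff_of_false (not_not.2 (hnonzero hz)) hz

theorem finite_spectrumOn_diff_ball (hP : IsIdempotentElem P) (haP : Commute a P)
    (hbr : ∀ z ∈ spectrumOn ℂ a P, z ≠ 0 → IsBrowder (shift (ofMap (a : X →ₗ[ℂ] X)) z))
    {r : ℝ} (hr : 0 < r) : (spectrumOn ℂ a P \ Metric.ball (0 : ℂ) r).Finite := by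
  by_contra hinf
  obtain ⟨z, ⟨hz, hzr⟩, hacc⟩ := Set.Infinite.exists_accPt_of_subset_isCompact hinf
    ((isCompact_spectrumOn hP haP).diff Metric.isOpen_ball) subset_rfl
  have hz0 : z ≠ 0 := fun h => hzr (h ▸ Metric.mem_ball_self hr)
  obtain ⟨w, hw, hwnot⟩ := ((accPt_iff_frequently_nhdsNE.1 hacc).and_eventually
    (eventually_notMem_spectrum_of_isBrowder (hbr z hz hz0))).exists
  exact hwnot (spectrumOn_subset_spectrum haP hw.1)

theorem exists_isSpectralIdempotent_ball (hP : IsIdempotentElem P) (haP : Commute a P)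
    (hunit : IsUnitOn a (1 - P))
    (hbr : ∀ z ∈ spectrumOn ℂ a P, z ≠ 0 → IsBrowder (shift (ofMap (a : X →ₗ[ℂ] X)) z)) :
    ∃ (Q : X →L[ℂ] X) (r : ℝ), 0 < r ∧ Q * P = Q ∧
      IsSpectralIdempotent a Q (Metric.ball (0 : ℂ) r) ∧
      spectrumOn ℂ a Q = spectrumOn ℂ a P ∩ Metric.ball (0 : ℂ) r := by
  obtain ⟨r, hr, hball⟩ := Metric.nhds_basis_ball.mem_iff.1
    ((isClosed_spectrumOn hP.one_sub ((Commute.one_right a).sub_right haP)).isOpen_compl.mem_nhds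
      (zero_notMem_spectrumOn (𝕜 := ℂ).2 hunit))
  have hfin := finite_spectrumOn_diff_ball hP haP hbr hr
  obtain ⟨e, he, hcomm⟩ := exists_isSpectralIdempotent_finset hfin.toFinset fun l hl => by
    obtain ⟨hlP, hlr⟩ := hfin.mem_toFinset.1 hl
    exact hbr l hlP fun h => hlr (h ▸ Metric.mem_ball_self hr)
  rw [hfin.coe_toFinset] at he
  have heP : Commute e P := hcomm P haP
  have hPe : Commute P (1 - e) := (Commute.one_right P).sub_right heP.symm
  have haQ : Commute a (P * (1 - e)) := haP.mul_right he.commute_one_sub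
  have hsubP : spectrumOn ℂ a (P * (1 - e)) ⊆ spectrumOn ℂ a P :=
    spectrumOn_mono haQ (by rw [← mul_assoc, hP.eq])
  have hsube : spectrumOn ℂ a (P * (1 - e)) ⊆ spectrumOn ℂ a (1 - e) :=
    spectrumOn_mono haQ (by rw [hPe.eq, ← mul_assoc, he.idem.one_sub.eq])
  have hsplit : 1 - P * (1 - e) = 1 - P + e * P := by rw [heP.eq]; noncomm_ring
  have hQ : IsSpectralIdempotent a (P * (1 - e)) (Metric.ball (0 : ℂ) r) := by
    refine ⟨hP.mul_of_commute hPe he.idem.one_sub, haQ, fun z hz => ?_, ?_⟩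
    · by_contra hzr
      exact he.disjoint.notMem_of_mem_left (hsube hz) ⟨hsubP hz, hzr⟩
    · rw [hsplit]
      refine Set.disjoint_of_subset_left spectrumOn_add_subset (Set.disjoint_union_left.2
        ⟨Set.subset_compl_iff_disjoint_left.1 hball, ?_⟩)
      exact Set.disjoint_of_subset_left ((spectrumOn_mono (he.commute.mul_right haP)
        (by rw [← mul_assoc, he.idem.eq])).trans he.subset) Set.disjoint_sdiff_left
  refine ⟨P * (1 - e), r, hr, by rw [mul_assoc, ← hPe.eq, ← mul_assoc, hP.eq], hQ, ?_⟩
  refine (Set.subset_inter hsubP hQ.subset).antisymm ?_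
  rw [hQ.spectrumOn_eq]
  exact Set.inter_subset_inter_left _ (spectrumOn_subset_spectrum haP)

end RieszPart

/-! ### Spectral projections and generalized inverses -/

section SpectralProjection

theorem isBoundedSpectralSet_inter {E : Type*} [AddCommGroup E] [Module ℂ E] {A : E →ₗ.[ℂ] E}
    {U : Set ℂ} (hU : IsOpen U) (hK : IsCompact (spec A ∩ U)) :
    IsBoundedSpectralSet A (spec A ∩ U) := by
  refine ⟨hK.isBounded, ?_, ?_, ?_⟩
  · rintro _ ⟨z, hz, rfl⟩
    exact Set.mem_insert_of_mem _ ⟨z, hz.1, rfl⟩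
  · exact (OnePoint.isClosed_image_coe.2 ⟨hK.isClosed, hK⟩).preimage continuous_subtype_val
  · convert (OnePoint.isOpen_image_coe.2 hU).preimage
      (continuous_subtype_val (p := (· ∈ extSpec A))) using 1
    ext ⟨w, hw⟩
    refine ⟨fun ⟨z, hz, hzw⟩ => ⟨z, hz.2, hzw⟩, ?_⟩
    rintro ⟨z, hz, rfl⟩
    obtain ⟨z', hz', hzz'⟩ := hw.resolve_left (OnePoint.coe_ne_infty z)
    exact ⟨z, ⟨OnePoint.coe_injective hzz' ▸ hz', hz⟩, rfl⟩

variable {X : Type*} [NormedAddCommGroup X] [NormedSpace ℂ X] {a Q : X →L[ℂ] X}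

theorem isReduction_ker_range (hQ : IsIdempotentElem Q) (haQ : Commute a Q) :
    IsReduction (ofMap (a : X →ₗ[ℂ] X)) Q.ker Q.range where
  closed_left := Q.isClosed_ker
  closed_right := ContinuousLinearMap.IsIdempotentElem.isClosed_range hQ
  map_left x hx := (congr($haQ.eq x).symm.trans (congrArg a hx)).trans a.map_zero
  le_domain _ _ := trivial
  map_right := by
    rintro ⟨_, _⟩ ⟨x, rfl⟩
    exact ⟨a x, congr($haQ.eq x).symm⟩
  isCompl := (ContinuousLinearMap.IsIdempotentElem.isTopCompl hQ).isCompl.symm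

theorem isGDRInvertible_of_isRiesz (hQ : IsIdempotentElem Q) (haQ : Commute a Q)
    (h : IsUnitOn a (1 - Q)) (hR : IsRiesz (a * Q)) : IsGDRInvertible (ofMap (a : X →ₗ[ℂ] X)) := by
  obtain ⟨d, had, hda⟩ := h
  have had' : a * (d * (1 - Q)) = 1 - Q := by rw [← mul_assoc, had, hQ.one_sub.eq]
  have hda' : d * (1 - Q) * a = 1 - Q := by
    rw [mul_assoc, ← ((Commute.one_right a).sub_right haQ).eq, ← mul_assoc, hda, hQ.one_sub.eq]
  have houter : d * (1 - Q) * (a * (d * (1 - Q))) = d * (1 - Q) := by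
    rw [had', mul_assoc, hQ.one_sub.eq]
  have hriesz : a * Q = a * (1 - a * (d * (1 - Q))) := by rw [had', sub_sub_cancel]
  exact ⟨d * (1 - Q), fun _ => trivial, fun _ => trivial, fun x => congr($houter x),
    fun x => congr($(hda'.trans had'.symm) x.1), a * Q, hR, fun x => congr($hriesz x)⟩

theorem isInverse_subMap_ofMap {b C : X →L[ℂ] X} (hr : (a - b) * C = 1) (hl : C * (a - b) = 1) :
    IsInverse (subMap (ofMap (a : X →ₗ[ℂ] X)) (b : X →ₗ[ℂ] X)) C :=
  ⟨fun _ => trivial, fun y => congr($hr y), fun x => congr($hl x.1)⟩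

variable [CompleteSpace X] {U : Set ℂ}

theorem IsSpectralIdempotent.isSpectralProjection (h : IsSpectralIdempotent a Q U)
    (hU : IsOpen U) :
    IsSpectralProjection (ofMap (a : X →ₗ[ℂ] X)) (spectrumOn ℂ a Q) Q := by
  have hcompact := isCompact_spectrumOn h.idem h.commute (𝕜 := ℂ)
  refine ⟨?_, h.idem, isReduction_ker_range h.idem h.commute, ?_, spec_part_ofMap h.idem h.commute⟩
  · rw [h.spectrumOn_eq, ← spec_ofMap] at hcompact ⊢
    exact isBoundedSpectralSet_inter hU hcompact
  · have hker : Q.ker = (1 - Q).range := LinearMap.IsIdempotentElem.ker_eq_range_one_sub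
      (ContinuousLinearMap.IsIdempotentElem.toLinearMap h.idem)
    rw [hker, spec_part_ofMap h.idem.one_sub h.commute_one_sub, h.spectrumOn_one_sub_eq,
      h.spectrumOn_eq, spec_ofMap, Set.sdiff_self_inter]

theorem exists_isDrazinInverse {r : ℝ}
    (h : IsSpectralIdempotent a Q (Metric.ball (0 : ℂ) r)) (h0 : 0 ∈ spectrumOn ℂ a Q) :
    ∃ D, IsDrazinInverse (ofMap (a : X →ₗ[ℂ] X)) (spectrumOn ℂ a Q) D ∧ D * a = 1 - Q := by
  have hr : 0 < r := Metric.pos_of_mem_ball (h.subset h0)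
  have hξ : ‖((2 * r + 1 : ℝ) : ℂ)‖ = 2 * r + 1 := by
    rw [Complex.norm_real, Real.norm_of_nonneg (by positivity)]
  have hsup : sSup ((‖·‖) '' spectrumOn ℂ a Q) ≤ r := Real.sSup_le
    (Set.forall_mem_image.2 fun z hz => (mem_ball_zero_iff.1 (h.subset hz)).le) hr.le
  have hunit : IsUnitOn a (1 - Q) := (zero_notMem_spectrumOn (𝕜 := ℂ)).1
    (Set.disjoint_right.1 h.disjoint (Metric.mem_ball_self hr))
  obtain ⟨C, hC, hC'⟩ := isUnit_iff_exists.1 <|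
    isUnit_sub_smul_idempotent h.idem h.commute hunit (z := ((2 * r + 1 : ℝ) : ℂ)) fun hmem => by
      have := mem_ball_zero_iff.1 (h.subset hmem)
      linarith
  refine ⟨C * (1 - Q), ⟨?_, h0, Q, h.isSpectralProjection Metric.isOpen_ball,
    ((2 * r + 1 : ℝ) : ℂ), by linarith, C, isInverse_subMap_ofMap hC hC', rfl⟩, ?_⟩
  · rw [spec_ofMap]
    exact spectrumOn_subset_spectrum h.commute h0
  · have hcorner : (1 - Q) * a = (a - ((2 * r + 1 : ℝ) : ℂ) • Q) * (1 - Q) := by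
      rw [sub_mul _ _ (1 - Q), smul_mul_assoc, h.idem.mul_one_sub_self, smul_zero, sub_zero,
        h.commute_one_sub.eq]
    rw [mul_assoc, hcorner, ← mul_assoc, hC', one_mul]

theorem exists_isSpectralProjection_isDrazinInverse (hP : IsIdempotentElem P) (haP : Commute a P)
    (hunit : IsUnitOn a (1 - P)) (hacc : AccPt 0 (𝓟 (spectrum ℂ (a * P))))
    (hbr : ∀ z ∈ spectrum ℂ (a * P), z ≠ 0 → IsBrowder (shift (ofMap (a : X →ₗ[ℂ] X)) z)) :
    IsGDRInvertible (ofMap (a : X →ₗ[ℂ] X)) ∧ ∃ Q, Q * P = Q ∧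
      IsSpectralProjection (ofMap (a : X →ₗ[ℂ] X)) (spectrum ℂ (a * Q)) Q ∧
      ∃ D, IsDrazinInverse (ofMap (a : X →ₗ[ℂ] X)) (spectrum ℂ (a * Q)) D ∧ D * a = 1 - Q := by
  have hbrP (z : ℂ) (hz : z ∈ spectrumOn ℂ a P) (hz0 : z ≠ 0) :=
    hbr z ((mem_spectrum_mul_iff hP haP hz0).2 hz) hz0
  obtain ⟨Q, r, hr, hQP, hQ, hσ⟩ := exists_isSpectralIdempotent_ball hP haP hunit hbrP
  have haccQ : AccPt 0 (𝓟 (spectrumOn ℂ a Q)) := by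
    rw [accPt_iff_frequently] at hacc ⊢
    refine (hacc.and_eventually (Metric.ball_mem_nhds 0 hr)).mono ?_
    rintro z ⟨⟨hz0, hz⟩, hzr⟩
    exact ⟨hz0, hσ ▸ ⟨(mem_spectrum_mul_iff hP haP hz0).1 hz, hzr⟩⟩
  have h0 : 0 ∈ spectrumOn ℂ a Q := (isClosed_spectrumOn hQ.idem hQ.commute).closure_subset
    (mem_closure_iff_clusterPt.2 haccQ.clusterPt)
  have hunitQ : IsUnitOn a (1 - Q) := (zero_notMem_spectrumOn (𝕜 := ℂ)).1
    (Set.disjoint_right.1 hQ.disjoint (Metric.mem_ball_self hr))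
  refine ⟨isGDRInvertible_of_isRiesz hQ.idem hQ.commute hunitQ (isRiesz_mul hQ.idem hQ.commute
    (fun z hz => hbrP z (hσ ▸ hz).1) haccQ), Q, hQP, ?_⟩
  rw [spectrum_mul_eq_spectrumOn hQ.idem hQ.commute h0]
  exact ⟨hQ.isSpectralProjection Metric.isOpen_ball, exists_isDrazinInverse hQ h0⟩

end SpectralProjection

/-! ### Semigroups -/

section Decay

theorem exists_le_mul_exp_of_submultiplicative {f : ℝ → ℝ} (hf : ∀ t, 0 ≤ t → 0 ≤ f t)
    (hadd : ∀ s t, 0 ≤ s → 0 ≤ t → f (s + t) ≤ f s * f t)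
    (hbdd : ∀ b, ∃ K, ∀ t ∈ Set.Icc 0 b, f t ≤ K) (hlim : Tendsto f atTop (𝓝 0)) :
    ∃ M ν : ℝ, 0 < M ∧ 0 < ν ∧ ∀ t, 0 ≤ t → f t ≤ M * Real.exp (-ν * t) := by
  obtain ⟨b, hfb, hb⟩ : ∃ b, f b < Real.exp (-1) ∧ 0 < b :=
    ((hlim.eventually_lt_const (Real.exp_pos (-1))).and (eventually_gt_atTop 0)).exists
  obtain ⟨K, hK⟩ := hbdd b
  have hK0 : 0 ≤ K := (hf b hb.le).trans (hK b ⟨hb.le, le_rfl⟩)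
  have hstep (n : ℕ) {r : ℝ} (hr : r ∈ Set.Icc 0 b) : f (n * b + r) ≤ Real.exp (-n) * K := by
    have hr0 := hr.1
    induction n with
    | zero => simpa using hK r hr
    | succ n ih => calc
        f ((n + 1 : ℕ) * b + r) = f (b + (n * b + r)) := by push_cast; ring_nf
        _ ≤ f b * f (n * b + r) := hadd _ _ hb.le (by positivity)
        _ ≤ Real.exp (-1) * (Real.exp (-n) * K) :=
          mul_le_mul hfb.le ih (hf _ (by positivity)) (Real.exp_pos _).le
        _ = Real.exp (-(n + 1 : ℕ)) * K := by
          rw [← mul_assoc, ← Real.exp_add]; push_cast; ring_nf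
  refine ⟨Real.exp 1 * (K + 1), 1 / b, by positivity, by positivity, fun t ht => ?_⟩
  have hfloor := Nat.floor_le (div_nonneg ht hb.le)
  have hfloor' := Nat.lt_floor_add_one (t / b)
  rw [le_div_iff₀ hb] at hfloor
  rw [div_lt_iff₀ hb] at hfloor'
  calc f t = f (⌊t / b⌋₊ * b + (t - ⌊t / b⌋₊ * b)) := by rw [add_sub_cancel]
    _ ≤ Real.exp (-⌊t / b⌋₊) * K := hstep _ ⟨by linarith, by linarith⟩
    _ ≤ Real.exp (1 + -(1 / b) * t) * (K + 1) := by
      have : -(⌊t / b⌋₊ : ℝ) ≤ 1 + -(1 / b) * t := by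
        rw [neg_mul, one_div_mul_eq_div]
        linarith [Nat.lt_floor_add_one (t / b)]
      gcongr
      linarith
    _ = Real.exp 1 * (K + 1) * Real.exp (-(1 / b) * t) := by rw [Real.exp_add]; ring

theorem exists_clm_apply_eq_integral {α 𝕜 E F : Type*} [MeasurableSpace α] {m : Measure α}
    [RCLike 𝕜] [NormedAddCommGroup E] [NormedSpace 𝕜 E] [NormedAddCommGroup F] [NormedSpace 𝕜 F]
    [NormedSpace ℝ F] [SMulCommClass ℝ 𝕜 F] {S : α → E →L[𝕜] F} {g : α → ℝ}
    (hS : ∀ x, AEStronglyMeasurable (fun t => S t x) m) (hg : Integrable g m)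
    (hSg : ∀ᵐ t ∂m, ‖S t‖ ≤ g t) :
    (∀ x, Integrable (fun t => S t x) m) ∧ ∃ J : E →L[𝕜] F, ∀ x, J x = ∫ t, S t x ∂m := by
  have hbound (x : E) : ∀ᵐ t ∂m, ‖S t x‖ ≤ g t * ‖x‖ :=
    hSg.mono fun t ht => (S t).le_of_opNorm_le ht x
  have hint (x : E) : Integrable (fun t => S t x) m := (hg.mul_const ‖x‖).mono' (hS x) (hbound x)
  let J : E →ₗ[𝕜] F :=
    { toFun x := ∫ t, S t x ∂m
      map_add' x y := by simp only [map_add, integral_add (hint x) (hint y)]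
      map_smul' c x := by simp only [map_smul, integral_smul, RingHom.id_apply] }
  refine ⟨hint, J.mkContinuous (∫ t, g t ∂m) fun x => ?_, fun _ => rfl⟩
  rw [← integral_mul_const]
  exact norm_integral_le_of_norm_le (hg.mul_const ‖x‖) (hbound x)

end Decay

section Semigroup

variable {X : Type*} [NormedAddCommGroup X] [NormedSpace ℂ X] {T : ℝ → X →L[ℂ] X}

theorem map_integral_orbit [CompleteSpace X] {L : X →L[ℂ] X}
    (hL : ∀ t, 0 ≤ t → (T t).comp L = L.comp (T t)) {y : X}
    (hint : IntegrableOn (fun t => T t y) (Set.Ioi 0)) :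
    L (∫ t in Set.Ioi 0, T t y) = ∫ t in Set.Ioi 0, T t (L y) := by
  rw [← L.integral_comp_comm hint]
  exact setIntegral_congr_fun measurableSet_Ioi fun t ht => congr($(hL t (le_of_lt ht)) y).symm

theorem commute_integral_orbit [CompleteSpace X] {B J L : X →L[ℂ] X}
    (hL : ∀ t, 0 ≤ t → (T t).comp L = L.comp (T t)) (hLB : Commute L B)
    (hint : ∀ x, IntegrableOn (fun t => T t (B x)) (Set.Ioi 0))
    (hJ : ∀ x, J x = ∫ t in Set.Ioi 0, T t (B x)) : Commute L J := by
  ext x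
  have hLBx : L (B x) = B (L x) := congr($hLB.eq x)
  rw [mul_apply_eq_comp, mul_apply_eq_comp, hJ, hJ, map_integral_orbit hL (hint x), hLBx]

namespace IsC0Semigroup

theorem comp_comm (hT : IsC0Semigroup T) {s t : ℝ} (hs : 0 ≤ s) (ht : 0 ≤ t) :
    (T t).comp (T s) = (T s).comp (T t) := by
  rw [← hT.add t s ht hs, ← hT.add s t hs ht, add_comm]

theorem tendsto_nhdsGE (hT : IsC0Semigroup T) (x : X) :
    Tendsto (fun t => T t x) (𝓝[≥] 0) (𝓝 x) := by
  rw [← Set.Ioi_insert, nhdsWithin_insert, tendsto_sup]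
  refine ⟨?_, hT.strongCont x⟩
  simpa only [hT.zero, ContinuousLinearMap.id_apply] using tendsto_pure_nhds (fun t => T t x) 0

theorem exists_norm_le_near_zero [CompleteSpace X] (hT : IsC0Semigroup T) :
    ∃ δ > 0, ∃ K, ∀ t ∈ Set.Icc 0 δ, ‖T t‖ ≤ K := by
  by_contra! hunbdd
  choose t ht htn using fun n : ℕ => hunbdd (1 / (n + 1)) Nat.one_div_pos_of_nat n
  have htlim : Tendsto t atTop (𝓝[≥] 0) := tendsto_nhdsWithin_iff.2
    ⟨squeeze_zero (fun n => (ht n).1) (fun n => (ht n).2) tendsto_one_div_add_atTop_nhds_zero_nat,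
      .of_forall fun n => (ht n).1⟩
  obtain ⟨K, hK⟩ := banach_steinhaus (g := fun n => T (t n)) fun x => by
    obtain ⟨C, hC⟩ := ((hT.tendsto_nhdsGE x).comp htlim).norm.bddAbove_range
    exact ⟨C, fun n => hC ⟨n, rfl⟩⟩
  obtain ⟨n, hn⟩ := exists_nat_gt K
  exact ((htn n).trans_le (hK n)).not_gt hn

theorem exists_norm_le_Icc [CompleteSpace X] (hT : IsC0Semigroup T) (b : ℝ) :
    ∃ K, ∀ t ∈ Set.Icc 0 b, ‖T t‖ ≤ K := by
  obtain ⟨δ, hδ, K, hK⟩ := hT.exists_norm_le_near_zero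
  have hK0 : 0 ≤ K := (norm_nonneg _).trans (hK 0 ⟨le_rfl, hδ.le⟩)
  obtain ⟨n, hn⟩ := exists_nat_ge (b / δ)
  rw [div_le_iff₀ hδ] at hn
  suffices ∀ n : ℕ, ∃ C, ∀ t ∈ Set.Icc 0 (n * δ), ‖T t‖ ≤ C from
    (this n).imp fun C hC t ht => hC t ⟨ht.1, ht.2.trans hn⟩
  intro n
  induction n with
  | zero => exact ⟨K, fun t ht => hK t ⟨ht.1, ht.2.trans (by simpa using hδ.le)⟩⟩
  | succ n ih =>
    obtain ⟨C, hC⟩ := ih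
    refine ⟨max K (K * C), fun t ht => ?_⟩
    rcases le_total t δ with htδ | htδ
    · exact (hK t ⟨ht.1, htδ⟩).trans (le_max_left _ _)
    · rw [← add_sub_cancel δ t, hT.add δ (t - δ) hδ.le (sub_nonneg.2 htδ)]
      refine ((T δ).opNorm_comp_le _).trans (le_max_of_le_right (mul_le_mul
        (hK δ ⟨hδ.le, le_rfl⟩) (hC _ ⟨sub_nonneg.2 htδ, ?_⟩) (norm_nonneg _) hK0))
      have := ht.2
      push_cast at this
      linarith

theorem norm_sub_le (hT : IsC0Semigroup T) {b K : ℝ} (hK : ∀ t ∈ Set.Icc 0 b, ‖T t‖ ≤ K) (x : X)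
    {s t : ℝ} (hs : s ∈ Set.Icc 0 b) (ht : t ∈ Set.Icc 0 b) :
    ‖T t x - T s x‖ ≤ K * ‖T |t - s| x - x‖ := by
  wlog hst : s ≤ t generalizing s t
  · rw [norm_sub_rev, abs_sub_comm]
    exact this ht hs (le_of_not_ge hst)
  have hadd : T t = (T s).comp (T |t - s|) := by
    rw [← hT.add s _ hs.1 (abs_nonneg _), abs_of_nonneg (sub_nonneg.2 hst), add_sub_cancel]
  rw [hadd, ContinuousLinearMap.comp_apply, ← map_sub]
  exact (T s).le_of_opNorm_le (hK s hs) _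

variable [CompleteSpace X]

theorem continuousOn (hT : IsC0Semigroup T) (x : X) :
    ContinuousOn (fun t => T t x) (Set.Ici 0) := by
  intro s hs
  obtain ⟨K, hK⟩ := hT.exists_norm_le_Icc (s + 1)
  have habs : Tendsto (fun t : ℝ => |t - s|) (𝓝[Set.Ici 0] s) (𝓝[≥] 0) := by
    refine tendsto_nhdsWithin_iff.2 ⟨?_, .of_forall fun t => Set.mem_Ici.2 (abs_nonneg _)⟩
    have : Continuous fun t : ℝ => |t - s| := by fun_prop
    simpa using (this.tendsto s).mono_left nhdsWithin_le_nhds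
  have hlim : Tendsto (fun t => K * ‖T |t - s| x - x‖) (𝓝[Set.Ici 0] s) (𝓝 0) := by
    simpa using (((hT.tendsto_nhdsGE x).comp habs).sub_const x).norm.const_mul K
  refine tendsto_iff_norm_sub_tendsto_zero.2
    (squeeze_zero' (.of_forall fun t => norm_nonneg _) ?_ hlim)
  filter_upwards [self_mem_nhdsWithin, nhdsWithin_le_nhds (Iic_mem_nhds (lt_add_one s))]
    with t ht hts
  exact hT.norm_sub_le hK x ⟨hs, (lt_add_one s).le⟩ ⟨ht, hts⟩

theorem exists_norm_comp_le_exp (hT : IsC0Semigroup T) {B : X →L[ℂ] X} (hB : IsIdempotentElem B)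
    (hcomm : ∀ t, 0 ≤ t → (T t).comp B = B.comp (T t))
    (hlim : Tendsto (fun t => ‖(T t).comp B‖) atTop (𝓝 0)) :
    ∃ M ν : ℝ, 0 < M ∧ 0 < ν ∧ ∀ t, 0 ≤ t → ‖(T t).comp B‖ ≤ M * Real.exp (-ν * t) := by
  refine exists_le_mul_exp_of_submultiplicative (fun _ _ => norm_nonneg _) (fun s t hs ht => ?_)
    (fun b => ?_) hlim
  · have hmul : (T (s + t)).comp B = ((T s).comp B).comp ((T t).comp B) := by
      rw [hT.add s t hs ht, ContinuousLinearMap.comp_assoc (T s) B,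
        ← ContinuousLinearMap.comp_assoc B, ← hcomm t ht, ContinuousLinearMap.comp_assoc (T t),
        ← ContinuousLinearMap.mul_def B, hB.eq, ContinuousLinearMap.comp_assoc]
    rw [hmul]
    exact ContinuousLinearMap.opNorm_comp_le _ _
  · obtain ⟨K, hK⟩ := hT.exists_norm_le_Icc b
    exact ⟨K * ‖B‖, fun t ht => ((T t).opNorm_comp_le B).trans
      (mul_le_mul_of_nonneg_right (hK t ht) (norm_nonneg _))⟩

theorem exists_integral_comp (hT : IsC0Semigroup T) {B : X →L[ℂ] X} {M ν : ℝ} (hν : 0 < ν)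
    (hM : ∀ t, 0 ≤ t → ‖(T t).comp B‖ ≤ M * Real.exp (-ν * t)) :
    (∀ x, IntegrableOn (fun t => T t (B x)) (Set.Ioi 0)) ∧
      ∃ J : X →L[ℂ] X, ∀ x, J x = ∫ t in Set.Ioi 0, T t (B x) := by
  have hmeas (x : X) : AEStronglyMeasurable (fun t => (T t).comp B x)
      (volume.restrict (Set.Ioi 0)) :=
    ((hT.continuousOn (B x)).mono Set.Ioi_subset_Ici_self).aestronglyMeasurable measurableSet_Ioi
  refine exists_clm_apply_eq_integral hmeas
    ((integrableOn_exp_mul_Ioi (neg_neg_of_pos hν) 0).const_mul M) ?_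
  filter_upwards [ae_restrict_mem measurableSet_Ioi] with t ht
  exact hM t (le_of_lt ht)

theorem map_integral_orbit_sub (hT : IsC0Semigroup T) {y : X}
    (hint : IntegrableOn (fun t => T t y) (Set.Ioi 0)) {h : ℝ} (hh : 0 ≤ h) :
    T h (∫ t in Set.Ioi 0, T t y) - ∫ t in Set.Ioi 0, T t y = -∫ t in 0..h, T t y := by
  have hshift : T h (∫ t in Set.Ioi 0, T t y) = ∫ t in Set.Ioi h, T t y := by
    have hcongr : ∫ t in Set.Ioi 0, T t (T h y) = ∫ t in Set.Ioi 0, T (t + h) y :=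
      setIntegral_congr_fun measurableSet_Ioi fun t ht =>
        congr($(hT.add t h (le_of_lt ht) hh) y).symm
    have htrans := (measurePreserving_add_right volume h).setIntegral_preimage_emb
      (measurableEmbedding_addRight h) (fun t => T t y) (Set.Ioi h)
    rw [Set.preimage_add_const_Ioi, sub_self] at htrans
    rw [map_integral_orbit (fun t ht => hT.comp_comm hh ht) hint, hcongr, htrans]
  rw [hshift, intervalIntegral.integral_of_le hh, ← Set.Ioc_union_Ioi_eq_Ioi hh,
    setIntegral_union (Set.Ioc_disjoint_Ioi le_rfl) measurableSet_Ioi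
      (hint.mono_set Set.Ioc_subset_Ioi_self) (hint.mono_set (Set.Ioi_subset_Ioi hh))]
  abel

theorem integral_orbit_mem_graph (hT : IsC0Semigroup T) {A : X →ₗ.[ℂ] X} (hgen : IsGenerator T A)
    {y : X} (hint : IntegrableOn (fun t => T t y) (Set.Ioi 0)) :
    (∫ t in Set.Ioi 0, T t y, -y) ∈ A.graph := by
  rw [hgen]
  have hderiv : HasDerivWithinAt (fun u => ∫ t in 0..u, T t y) (T 0 y) (Set.Ioi 0) 0 :=
    (intervalIntegral.integral_hasDerivWithinAt_right (s := Set.Ici 0) (t := Set.Ioi 0)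
      (by simp) ⟨Set.Ioi 0, self_mem_nhdsWithin, hint.1⟩
      ((hT.continuousOn y 0 Set.self_mem_Ici).mono Set.Ioi_subset_Ici_self)).mono
      Set.Ioi_subset_Ici_self
  rw [hasDerivWithinAt_iff_tendsto_slope' (by simp), hT.zero] at hderiv
  refine hderiv.neg.congr' ?_
  filter_upwards [self_mem_nhdsWithin] with h hh
  rw [hT.map_integral_orbit_sub hint (le_of_lt hh), slope_def_module,
    intervalIntegral.integral_same, sub_zero, sub_zero, smul_neg, ← Complex.ofReal_inv,
    Complex.coe_smul]

end IsC0Semigroup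

end Semigroup

section Generator

theorem mem_graph_pcomp {E : Type*} [AddCommGroup E] [Module ℂ E] {f g : E →ₗ.[ℂ] E} {x y z : E}
    (hf : (x, y) ∈ f.graph) (hg : (y, z) ∈ g.graph) : (x, z) ∈ (pcomp g f).graph := by
  obtain ⟨⟨x, hx⟩, rfl, rfl⟩ := (LinearPMap.mem_graph_iff _).1 hf
  obtain ⟨⟨_, hw⟩, rfl, hz⟩ := (LinearPMap.mem_graph_iff _).1 hg
  exact (LinearPMap.mem_graph_iff _).2 ⟨⟨x, hx, hw⟩, rfl, hz⟩

theorem mem_domain_of_pow_domain_eq {E : Type*} [AddCommGroup E] [Module ℂ E] {A : E →ₗ.[ℂ] E}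
    {G : E →ₗ[ℂ] E} {M : Submodule ℂ E} (hGM : ∀ x ∈ M, G x ∈ M)
    (hG : ∀ x ∈ M, (G x, x) ∈ A.graph) {j : ℕ}
    (hj : (pow A (j + 1)).domain = (pow A j).domain) {x : E} (hx : x ∈ M) : x ∈ A.domain := by
  have hpow (n : ℕ) : ∀ y ∈ M, ((G ^ n) y, y) ∈ (pow A n).graph := by
    induction n with
    | zero => exact fun y _ => mem_graph_ofMap.2 rfl
    | succ n ih =>
      intro y hy
      rw [pow_succ, Module.End.mul_apply]
      exact mem_graph_pcomp (ih (G y) (hGM y hy)) (hG y hy)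
  obtain ⟨w, -, rfl⟩ := (LinearPMap.mem_graph_iff _).1 (hpow j x hx)
  obtain ⟨_, h⟩ : (w : E) ∈ (pow A (j + 1)).domain := hj.symm ▸ w.2
  exact h

namespace IsGenerator

variable {X : Type*} [NormedAddCommGroup X] [NormedSpace ℂ X] {T : ℝ → X →L[ℂ] X}
  {A : X →ₗ.[ℂ] X} {a B J : X →L[ℂ] X}

theorem tendsto_ofMap (hgen : IsGenerator T (ofMap (a : X →ₗ[ℂ] X))) (x : X) :
    Tendsto (fun t : ℝ => (t : ℂ)⁻¹ • (T t x - x)) (𝓝[>] 0) (𝓝 (a x)) :=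
  (hgen x (a x)).1 (mem_graph_ofMap.2 rfl)

theorem commute (hgen : IsGenerator T (ofMap (a : X →ₗ[ℂ] X)))
    (hcomm : ∀ t, 0 ≤ t → (T t).comp B = B.comp (T t)) : Commute a B := by
  refine ContinuousLinearMap.ext fun x => tendsto_nhds_unique (hgen.tendsto_ofMap (B x))
    (((B.continuous.tendsto _).comp (hgen.tendsto_ofMap x)).congr' ?_)
  filter_upwards [self_mem_nhdsWithin] with t ht
  have hTB : T t (B x) = B (T t x) := congr($(hcomm t (le_of_lt ht)) x)
  rw [Function.comp_apply, map_smul, map_sub, hTB]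

variable [CompleteSpace X]

theorem exists_eq_ofMap (hgen : IsGenerator T A) (hdom : A.domain = ⊤) :
    ∃ a : X →L[ℂ] X, A = ofMap (a : X →ₗ[ℂ] X) := by
  have hmem (x : X) : x ∈ A.domain := hdom ▸ trivial
  have hlim : Tendsto (fun (t : ℝ) x => ((t : ℂ)⁻¹ • (T t - 1)) x) (𝓝[>] 0)
      (𝓝 fun x => A ⟨x, hmem x⟩) :=
    tendsto_pi_nhds.2 fun x => (hgen x _).1 (A.mem_graph ⟨x, hmem x⟩)
  exact ⟨continuousLinearMapOfTendsto _ hlim,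
    linearPMap_ext_of_domain_eq_top hdom rfl fun x _ _ => rfl⟩

theorem domain_eq_top (hgen : IsGenerator T A) (hT : IsC0Semigroup T)
    (hdom : ∃ j, (pow A (j + 1)).domain = (pow A j).domain) (hB : IsIdempotentElem B)
    (hcomm : ∀ t, 0 ≤ t → (T t).comp B = B.comp (T t)) (hran : ∀ x, x - B x ∈ A.domain)
    (hint : ∀ x, IntegrableOn (fun t => T t (B x)) (Set.Ioi 0))
    (hJ : ∀ x, J x = ∫ t in Set.Ioi 0, T t (B x)) : A.domain = ⊤ := by
  obtain ⟨j, hj⟩ := hdom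
  have hBB (x : X) : B (B x) = B x := congr($hB.eq x)
  have hBJ (x : X) : B (J x) = J x := by rw [hJ, map_integral_orbit hcomm (hint x), hBB]
  have hmem (x : X) : B x ∈ A.domain := by
    refine mem_domain_of_pow_domain_eq (G := ((-J : X →L[ℂ] X) : X →ₗ[ℂ] X))
      (M := LinearMap.range (B : X →ₗ[ℂ] X)) (fun y _ => ⟨-J y, ?_⟩) ?_ hj ⟨x, rfl⟩
    · exact (map_neg B _).trans congr(-$(hBJ y))
    · rintro _ ⟨y, rfl⟩
      have := A.graph.neg_mem (hT.integral_orbit_mem_graph hgen (hint (B y)))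
      rwa [← hJ, hBB, Prod.neg_mk, neg_neg] at this
  exact eq_top_iff.2 fun x _ => by simpa using A.domain.add_mem (hran x) (hmem x)

theorem mul_integral_orbit (hgen : IsGenerator T (ofMap (a : X →ₗ[ℂ] X))) (hT : IsC0Semigroup T)
    (hint : ∀ x, IntegrableOn (fun t => T t (B x)) (Set.Ioi 0))
    (hJ : ∀ x, J x = ∫ t in Set.Ioi 0, T t (B x)) : a * J = -B := by
  ext x
  rw [mul_apply_eq_comp, hJ]
  exact mem_graph_ofMap.1 (hT.integral_orbit_mem_graph hgen (hint x))

theorem exists_eq_ofMap_integral_orbit (hgen : IsGenerator T A) (hT : IsC0Semigroup T)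
    (hdom : ∃ j, (pow A (j + 1)).domain = (pow A j).domain) (hB : IsIdempotentElem B)
    (hcomm : ∀ t, 0 ≤ t → (T t).comp B = B.comp (T t)) (hran : ∀ x, x - B x ∈ A.domain)
    (hint : ∀ x, IntegrableOn (fun t => T t (B x)) (Set.Ioi 0))
    (hJ : ∀ x, J x = ∫ t in Set.Ioi 0, T t (B x)) :
    ∃ a : X →L[ℂ] X, A = ofMap (a : X →ₗ[ℂ] X) ∧ Commute a B ∧ a * J = -B ∧ J * a = -B ∧
      B * J = J := by
  obtain ⟨a, rfl⟩ := hgen.exists_eq_ofMap (hgen.domain_eq_top hT hdom hB hcomm hran hint hJ)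
  have haJ := hgen.mul_integral_orbit hT hint hJ
  have hJT (t : ℝ) (ht : 0 ≤ t) : (T t).comp J = J.comp (T t) :=
    commute_integral_orbit (fun s hs => hT.comp_comm ht hs) (hcomm t ht) hint hJ
  refine ⟨a, rfl, hgen.commute hcomm, haJ, (hgen.commute hJT).eq ▸ haJ, ?_⟩
  rw [(commute_integral_orbit hcomm (.refl B) hint hJ).eq]
  ext x
  rw [mul_apply_eq_comp, hJ, hJ, show B (B x) = B x from congr($hB.eq x)]

end IsGenerator

end Generator

end DrazinRiesz

theorem mainTheorem2_general {X : Type*} [NormedAddCommGroup X] [NormedSpace ℂ X]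
    [CompleteSpace X] {T : ℝ → X →L[ℂ] X} (hT : IsC0Semigroup T) {A : X →ₗ.[ℂ] X}
    (hgen : IsGenerator T A) (hdom : ∃ j, (pow A (j + 1)).domain = (pow A j).domain)
    {P : X →L[ℂ] X} (hP : IsIdempotentElem P)
    (hcomm : ∀ t, 0 ≤ t → (T t).comp P = P.comp (T t)) (hran : ∀ x, P x ∈ A.domain)
    (hlim : Tendsto (fun t => ‖(T t).comp (ContinuousLinearMap.id ℂ X - P)‖) atTop (𝓝 0))
    (hacc : AccPt 0 (𝓟 (spec (mulBdd A P))))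
    (hbr : ∀ z ∈ spec (mulBdd A P), z ≠ 0 → IsBrowder (shift A z))
    (h1 : 1 ∉ spec (mulBdd A P)) :
    IsGDRInvertible A ∧
    ∃ Q : X →L[ℂ] X, IsSpectralProjection A (spec (mulBdd A Q)) Q ∧
    ∃ D : X →L[ℂ] X, IsDrazinInverse A (spec (mulBdd A Q)) D ∧
    ∃ C : X →L[ℂ] X, IsInverse (subMap A (P : X →ₗ[ℂ] X)) C ∧
    (∃ M ν : ℝ, 0 < M ∧ 0 < ν ∧ ∀ t : ℝ, 0 ≤ t →
      ‖(T t).comp (ContinuousLinearMap.id ℂ X - P)‖ ≤ M * Real.exp (-ν * t)) ∧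
    D.comp (ContinuousLinearMap.id ℂ X - P) = C.comp (ContinuousLinearMap.id ℂ X - P) ∧
    ∀ x : X, IntegrableOn (fun t : ℝ => T t (x - P x)) (Set.Ioi 0) ∧
      C (x - P x) = - ∫ t in Set.Ioi (0 : ℝ), T t (x - P x) := by
  have hTB (t : ℝ) (ht : 0 ≤ t) : (T t).comp (1 - P) = (1 - P).comp (T t) :=
    (Commute.one_right (T t)).sub_right (hcomm t ht)
  obtain ⟨M, ν, hM, hν, hdecay⟩ := hT.exists_norm_comp_le_exp hP.one_sub hTB hlim
  obtain ⟨hint, J, hJ⟩ := hT.exists_integral_comp hν hdecay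
  obtain ⟨a, rfl, haB, haJ, hJa, hBJ⟩ := hgen.exists_eq_ofMap_integral_orbit hT hdom hP.one_sub hTB
    (fun x => by simpa using hran x) hint hJ
  have haP : Commute a P := by simpa using (Commute.one_right a).sub_right haB
  have hunit : IsUnitOn a (1 - P) :=
    ⟨-J, by rw [mul_neg, haJ, neg_neg], by rw [neg_mul, hJa, neg_neg]⟩
  simp only [mulBdd_ofMap, spec_ofMap] at hacc hbr h1 ⊢
  obtain ⟨hgdr, Q, hQP, hQ, D, hD, hDa⟩ :=
    exists_isSpectralProjection_isDrazinInverse hP haP hunit hacc hbr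
  obtain ⟨C, hC, hC'⟩ := isUnit_iff_exists.1 <| isUnit_sub_smul_idempotent hP haP hunit
    ((mem_spectrum_mul_iff hP haP one_ne_zero).not.1 h1)
  rw [one_smul] at hC hC'
  have hPJ : P * J = 0 := by rw [← hBJ, ← mul_assoc, hP.mul_one_sub_self, zero_mul]
  have hDJ : D * (1 - P) = -J := by
    rw [← neg_neg (1 - P), ← haJ, mul_neg, ← mul_assoc, hDa, sub_mul, one_mul, ← hQP,
      mul_assoc, hPJ, mul_zero, sub_zero]
  have hCJ : C * (1 - P) = -J := by
    have haPJ : (a - P) * J = -(1 - P) := by rw [sub_mul, haJ, hPJ, sub_zero]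
    rw [← neg_neg (1 - P), ← haPJ, mul_neg, ← mul_assoc, hC', one_mul]
  exact ⟨hgdr, Q, hQ, D, hD, C, isInverse_subMap_ofMap hC hC', ⟨M, ν, hM, hν, hdecay⟩,
    hDJ.trans hCJ.symm, fun x => ⟨hint x, congr($hCJ x).trans congr(-$(hJ x))⟩⟩

theorem mainTheorem2 {X : Type*} [NormedAddCommGroup X] [NormedSpace ℂ X] [CompleteSpace X]
    (hX : ¬ FiniteDimensional ℂ X)
    (T : ℝ → X →L[ℂ] X) (hT : IsC0Semigroup T) (hTb : ∃ K : ℝ, ∀ t : ℝ, 0 ≤ t → ‖T t‖ ≤ K)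
    (A : X →ₗ.[ℂ] X) (hA : IsHatClosed A) (hgen : IsGenerator T A)
    (hacc : AccPt (0 : ℂ) (𝓟 (spec A)))
    (P : X →L[ℂ] X) (hP : IsIdempotentElem P) (hP0 : P ≠ 0)
    (hcomm : ∀ t : ℝ, 0 ≤ t → (T t).comp P = P.comp (T t))
    (hran : ∀ x : X, P x ∈ A.domain)
    (hlim : Tendsto (fun t : ℝ => ‖(T t).comp (ContinuousLinearMap.id ℂ X - P)‖) atTop (𝓝 0))
    (μ : ℕ → ℂ) (hspec : spec (mulBdd A P) = insert 0 (Set.range μ))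
    (hμ : ∀ i, μ i ∈ rieszPoints A \ {0}) (hμlim : Tendsto μ atTop (𝓝 0))
    (hμanti : Antitone fun i => ‖μ i‖) (hμ0 : ‖μ 0‖ < 1 / 2) :
    IsGDRInvertible A ∧
    ∃ Q : X →L[ℂ] X, IsSpectralProjection A (spec (mulBdd A Q)) Q ∧
    ∃ D : X →L[ℂ] X, IsDrazinInverse A (spec (mulBdd A Q)) D ∧
    ∃ C : X →L[ℂ] X, IsInverse (subMap A (P : X →ₗ[ℂ] X)) C ∧
    (∃ M ν : ℝ, 0 < M ∧ 0 < ν ∧ ∀ t : ℝ, 0 ≤ t →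
      ‖(T t).comp (ContinuousLinearMap.id ℂ X - P)‖ ≤ M * Real.exp (-ν * t)) ∧
    D.comp (ContinuousLinearMap.id ℂ X - P) = C.comp (ContinuousLinearMap.id ℂ X - P) ∧
    ∀ x : X, IntegrableOn (fun t : ℝ => T t (x - P x)) (Set.Ioi 0) ∧
      C (x - P x) = - ∫ t in Set.Ioi (0 : ℝ), T t (x - P x) := by
  have hrange (i : ℕ) : μ i ∈ spec (mulBdd A P) := hspec ▸ .inr ⟨i, rfl⟩
  refine mainTheorem2_general hT hgen hA.domains.exists hP hcomm hran hlim ?_ ?_ ?_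
  · exact accPt_iff_frequently.2 (hμlim.frequently (.of_forall fun i => ⟨(hμ i).2, hrange i⟩))
  · rw [hspec]
    rintro _ (rfl | ⟨i, rfl⟩) hz
    exacts [absurd rfl hz, not_not.1 (hμ i).1.2]
  · rw [hspec]
    rintro (h | ⟨i, hi⟩)
    · exact one_ne_zero h
    · have := hμanti (Nat.zero_le i)
      simp only [hi, norm_one] at this
      linarith
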